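/- **Setting.** Let $T>0$, let $M\ge 2$ and $n_0\ge 1$ be integers, and put $\mathbf h=T/n_0$. On a filtered probability space let $W$ be a $q$-dimensional Brownian motion and let $X$ be the strong solution on $[0,T]$ of $$dX_t=b(X_t)\,dt+\sum_{j=1}^q\sigma_j(X_t)\,dW^j_t,\qquad X_0=x\in\mathbb R^d,$$ where $b,\sigma_1,\dots,\sigma_q$ are globally Lipschitz. Let $X^h$ be a one-step discretization scheme with step $h$ (for instance the Euler or the Milstein scheme), $X^h_{(i+1)h}=\Phi(h,X^h_{ih},W_{(i+1)h}-W_{ih})$ with $\Phi(h,\cdot,\cdot)$ Borel measurable. For $\theta\in\mathbb R^q$ let $X^h_{\cdot,\theta}$ be the same scheme with each increment $\Delta W$ replaced by $\Delta W+\theta h$, i.e. the scheme for the equation with drift $b+\sigma\theta$. Put $\mathcal J^-(W_T,\theta)=\exp(-\langle\theta,W_T\rangle-\tfrac12|\theta|^2T)$. Let $P:\mathbb R^d\to\mathbb R$ be Borel with $P(X_T)\in L^p$ and $\mathrm{Var}(P(X_T))>0$, where $p\ge2$. Let $\mathcal H=\{\mathbf h/n:n\ge1\}$ and assume: * *Weak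 error*: there are $\alpha>0$ and $(c_k)_{k\ge1}$ with $\mathbb E P(X^h_T)-\mathbb E P(X_T)=\sum_{k=1}^{\bar L}c_kh^{\alpha k}+o(h^{\alpha\bar L})$ as $h\to0$ in $\mathcal H$, for every $\bar L\ge1$, and $\tilde c_\infty=\lim_{L}|c_L|^{1/L}\in(0,\infty)$ exists. * *Strong error*: there are $\beta>0$ and $V_1>0$ with $\mathbb E|P(X^h_T)-P(X_T)|^2\le V_1h^\beta$ for $h\in\mathcal H$. * *$L^r$-strong error*: for some $r>p$ (for example $r=p^2$) and $V^{(r)}>0$, $\mathbb E|P(X^h_T)-P(X_T)|^r\le V^{(r)}h^{\beta r/2}$ for $h\in\mathcal H$. **Parameters.** For $L\ge1$ let $w=(w_1,\dots,w_L)$ solve $\sum_{j=1}^L M^{-\alpha(i-1)(j-1)}w_j=\mathbf 1_{\{i=1\}}$, $1\le i\le L$, and put $\widetilde W_l=\sum_{j=l}^Lw_j$. Let $\lambda=\sqrt{V_1/\mathrm{Var}(P(X_T))}$, $\underline C=\frac{1+M^{\beta/2}}{\sqrt{1+M^{-1}}}$, $\overline C=(1+M^{\beta/2})\sqrt{1+M^{-1}}$.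 For $\varepsilon>0$ set, with $a=\frac12+\frac{\log(\tilde c_\infty^{1/\alpha}\mathbf h)}{\log M}$, $$L=L(\varepsilon)=\Big\lceil a+\sqrt{a^2+\tfrac{2\log(\sqrt{1+4\alpha}/\varepsilon)}{\alpha\log M}}\Big\rceil,$$ $$\mu_1=q^*(1+\lambda\mathbf h^{\beta/2}),\qquad \mu_l=q^*\lambda\mathbf h^{\beta/2}\,\underline C\,|\widetilde W_l|\,M^{-\frac{1+\beta}2(l-1)}\ (2\le l\le L),\qquad \sum_{l=1}^L\mu_l=1,$$ $$N=\Big(1+\frac1{2\alpha L}\Big)\frac{\mathrm{Var}(P(X_T))\big(1+\lambda\mathbf h^{\beta/2}+\lambda\mathbf h^{\beta/2}\,\overline C\sum_{l=2}^L|\widetilde W_l|M^{\frac{1-\beta}2(l-1)}\big)}{\varepsilon^2q^*},\qquad N_l=\lceil N\mu_l\rceil .$$ (If $\varepsilon$ is so large that the square root is not real, it is read as $0$; for $L\le1$ the sum over levels below is empty.) **Estimator.** Let $(W^{l,k})_{l,k}$ be independent $q$-dimensional Brownian motions, $\mathcal F_{T,k}$ the $\sigma$-algebra generated by $W^{l,j}_t$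 for all $l$, $1\le j\le k$, $t\le T$, and let $\theta_l^k$ ($l\ge2$, $k\ge0$) be $\mathcal F_{T,k}$-measurable random vectors with values in a compact set $\Theta\subset\{|\theta|\le c\}\subset\mathbb R^q$, $c>0$. Write $n_l=n_0M^{l-1}$, let $X^{n_l,k}_{T,\theta}$ be the terminal value of the scheme with $n_l$ steps of size $T/n_l$ driven by $W^{l,k}$, and $X^{n_{l-1},k}_{T,\theta}$ that of the scheme with $n_{l-1}$ steps driven by the same path. Let $$\widetilde Y^k_{l,\theta}=\big(P(X^{n_l,k}_{T,\theta})-P(X^{n_{l-1},k}_{T,\theta})\big)\mathcal J^-(W^{l,k}_T,\theta)-\mathbb E\big[P(X^{n_l}_T)-P(X^{n_{l-1}}_T)\big],\qquad \widetilde{\mathbf J}^{2,\varepsilon}_{\theta,\pi}=\sum_{l=2}^{L}\frac{\widetilde W_l}{N_l}\sum_{k=1}^{N_l}\widetilde Y^k_{l,\theta_l^{k-1}}$$ (a level with $\widetilde W_l=0$ contributes $0$). **Proposition.** There is a constant $K_2>0$, depending only on $M,\beta,p,c$ and on $T,\mathbf h,V_1,r,V^{(r)}$ (in particular not on $\varepsilon$,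 on $L$, nor on the sequences $\theta_l^k$), such that for every $\varepsilon>0$ $$\mathbb E\big[|\widetilde{\mathbf J}^{2,\varepsilon}_{\theta,\pi}|^p\big]\le K_2\,\varepsilon^p .$$ -/

import Mathlib

open MeasureTheory ProbabilityTheory Filter Topology Set
open scoped NNReal ENNReal Matrix

noncomputable section

/-- Euclidean space `ℝⁿ`. -/
abbrev Vec (n : ℕ) : Type := EuclideanSpace ℝ (Fin n)

/-! ### Brownian motion and stochastic differential equations -/

/-- A standard `q`-dimensional Brownian motion: the coordinates are independent real Brownian
motions. -/
structure IsBrownianMotion {Ω : Type*} [MeasurableSpace Ω] {q : ℕ}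
    (W : ℝ≥0 → Ω → Vec q) (μ : Measure Ω) : Prop where
  measurable : ∀ t, Measurable (W t)
  coord : ∀ j : Fin q, IsBrownianReal (fun t ω => W t ω j) μ
  indep : iIndepFun (fun (j : Fin q) (ω : Ω) (t : ℝ≥0) => W t ω j) μ

/-- A standard `q`-dimensional Brownian motion relative to the filtration `ℱ`. -/
structure IsFilteredBrownianMotion {Ω : Type*} [mΩ : MeasurableSpace Ω] {q : ℕ}
    (ℱ : Filtration ℝ≥0 mΩ) (W : ℝ≥0 → Ω → Vec q) (μ : Measure Ω) : Prop where
  isBrownianMotion : IsBrownianMotion W μ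
  adapted : ∀ t, Measurable[ℱ t] (W t)
  indep_past : ∀ s t : ℝ≥0, s ≤ t →
    Indep (MeasurableSpace.comap (fun ω => W t ω - W s ω) inferInstance) (ℱ s) μ

/-- The left-point Riemann sum `∑ᵢ ∑ⱼ σⱼ(X_{tᵢ}) (Wʲ_{tᵢ₊₁} - Wʲ_{tᵢ})` over the uniform partition
`tᵢ = i t / n` of `[0, t]`. -/
def itoSum {Ω : Type*} {d q : ℕ} (σ : Fin q → Vec d → Vec d) (X : ℝ≥0 → Ω → Vec d)
    (W : ℝ≥0 → Ω → Vec q) (t : ℝ≥0) (n : ℕ) (ω : Ω) : Vec d :=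
  ∑ i ∈ Finset.range n, ∑ j : Fin q,
    (W (((i : ℝ≥0) + 1) * t / n) ω j - W ((i : ℝ≥0) * t / n) ω j) •
      σ j (X ((i : ℝ≥0) * t / n) ω)

/-- `X` is a strong solution on `[0, T]` of `dX = b(X) dt + ∑ⱼ σⱼ(X) dWʲ`, `X₀ = x`.
The integrands `σⱼ(X)` are continuous and adapted, so the Itô integral over `[0, t]` is the limit
in probability of the left-point Riemann sums; `eq` says that this limit is
`X_t - x - ∫₀ᵗ b(X_s) ds`. -/
structure IsStrongSolution {Ω : Type*} [mΩ : MeasurableSpace Ω] {d q : ℕ}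
    (ℱ : Filtration ℝ≥0 mΩ) (μ : Measure Ω) (b : Vec d → Vec d) (σ : Fin q → Vec d → Vec d)
    (x : Vec d) (T : ℝ≥0) (W : ℝ≥0 → Ω → Vec q) (X : ℝ≥0 → Ω → Vec d) : Prop where
  adapted : ∀ t ≤ T, Measurable[ℱ t] (X t)
  continuous : ∀ᵐ ω ∂μ, ContinuousOn (fun t => X t ω) (Iic T)
  init : ∀ᵐ ω ∂μ, X 0 ω = x
  eq : ∀ t ≤ T, TendstoInMeasure μ (fun n : ℕ => itoSum σ X W t n) atTop
    (fun ω => X t ω - x - ∫ s in (0 : ℝ)..t, b (X s.toNNReal ω))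

/-! ### Discretization schemes -/

/-- The scheme `X_{i+1} = Φ(h, X_i, ΔW_i + θ h)`, `X_0 = x`, with `n` steps of size `h = T / n`,
driven by the path `w` with drift `θ`. For `θ = 0` it discretizes the original equation; in general
it discretizes `dX(θ) = (b(X(θ)) + σ(X(θ)) θ) dt + σ(X(θ)) dW`. -/
def schemePath {d q : ℕ} (Φ : ℝ → Vec d → Vec q → Vec d) (x : Vec d) (T : ℝ≥0) (n : ℕ)
    (θ : Vec q) (w : ℝ≥0 → Vec q) : ℕ → Vec d
  | 0 => x
  | i + 1 => Φ ((T : ℝ) / n) (schemePath Φ x T n θ w i)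
      (w (((i : ℝ≥0) + 1) * T / n) - w ((i : ℝ≥0) * T / n) + ((T : ℝ) / n) • θ)

/-- The value at time `T` of the scheme with `n` steps. -/
def schemeEnd {d q : ℕ} (Φ : ℝ → Vec d → Vec q → Vec d) (x : Vec d) (T : ℝ≥0) (n : ℕ)
    (θ : Vec q) (w : ℝ≥0 → Vec q) : Vec d :=
  schemePath Φ x T n θ w n

/-- One step of the Euler-Maruyama scheme. -/
def eulerStep {d q : ℕ} (b : Vec d → Vec d) (σ : Fin q → Vec d → Vec d)
    (h : ℝ) (y : Vec d) (v : Vec q) : Vec d :=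
  y + h • b y + ∑ j, v j • σ j y

/-- One step of the Milstein scheme (without Lévy areas). -/
def milsteinStep {d q : ℕ} (b : Vec d → Vec d) (σ : Fin q → Vec d → Vec d)
    (h : ℝ) (y : Vec d) (v : Vec q) : Vec d :=
  eulerStep b σ h y v +
    (1 / 2 : ℝ) • ∑ i, ∑ j, (v i * v j - if i = j then h else 0) • fderiv ℝ (σ j) y (σ i y)

theorem measurable_eulerStep {d q : ℕ} {b : Vec d → Vec d} {σ : Fin q → Vec d → Vec d}
    (hb : Measurable b) (hσ : ∀ j, Measurable (σ j)) (h : ℝ) :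
    Measurable fun z : Vec d × Vec q => eulerStep b σ h z.1 z.2 := by
  unfold eulerStep
  fun_prop

/-- The likelihood ratio `𝒥⁻(w_T, θ) = exp(-⟨θ, w_T⟩ - ‖θ‖² T / 2)`. -/
def girsanovMinus {q : ℕ} (T : ℝ≥0) (wT θ : Vec q) : ℝ :=
  Real.exp (-inner ℝ θ wT - ‖θ‖ ^ 2 * T / 2)

/-! ### Error assumptions

The coarsest step size is `T / n₀`, and the step sizes considered are `(T / n₀) / n`, `n ≥ 1`. -/

/-- `𝔼 |P(X^h_T) - P(X_T)|^s ≤ V h^{β s / 2}` for all `h = (T / n₀) / n`, `n ≥ 1`. -/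
def StrongError {Ω : Type*} [MeasurableSpace Ω] {d q : ℕ} (μ : Measure Ω)
    (Φ : ℝ → Vec d → Vec q → Vec d) (x : Vec d) (T : ℝ≥0) (n₀ : ℕ) (P : Vec d → ℝ)
    (W : ℝ≥0 → Ω → Vec q) (X : ℝ≥0 → Ω → Vec d) (s β V : ℝ) : Prop :=
  ∀ n : ℕ, 1 ≤ n →
    ∫⁻ ω, ENNReal.ofReal
        (|P (schemeEnd Φ x T (n₀ * n) 0 (fun t => W t ω)) - P (X T ω)| ^ s) ∂μ
      ≤ ENNReal.ofReal (V * ((T : ℝ) / n₀ / n) ^ (β * s / 2))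

/-- The expansion `𝔼 P(X^h_T) - 𝔼 P(X_T) = ∑_{k ≤ L} c_k h^{α k} + o(h^{α L})` at every order
`L ≥ 1`, along `h = (T / n₀) / n`, `n → ∞`. -/
def WeakError {Ω : Type*} [MeasurableSpace Ω] {d q : ℕ} (μ : Measure Ω)
    (Φ : ℝ → Vec d → Vec q → Vec d) (x : Vec d) (T : ℝ≥0) (n₀ : ℕ) (P : Vec d → ℝ)
    (W : ℝ≥0 → Ω → Vec q) (X : ℝ≥0 → Ω → Vec d) (α : ℝ) (coef : ℕ → ℝ) : Prop :=
  ∀ L : ℕ, 1 ≤ L →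
    (fun n : ℕ =>
        (∫ ω, P (schemeEnd Φ x T (n₀ * n) 0 (fun t => W t ω)) ∂μ) - (∫ ω, P (X T ω) ∂μ)
          - ∑ k ∈ Finset.Icc 1 L, coef k * ((T : ℝ) / n₀ / n) ^ (α * k))
      =o[atTop] (fun n : ℕ => ((T : ℝ) / n₀ / n) ^ (α * L))

/-! ### Parameters of the multilevel Richardson-Romberg estimator -/

/-- The Vandermonde matrix with entries `n_j^{-α (i-1)}`, `n_j = M^{j-1}`, `1 ≤ i, j ≤ L`
(the indices of `Fin L` start at `0`). -/
def vdm (M : ℕ) (α : ℝ) (L : ℕ) : Matrix (Fin L) (Fin L) ℝ :=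
  (Matrix.vandermonde fun j : Fin L => (((M : ℝ) ^ (j : ℕ)) ^ (-α)))ᵀ

/-- The solution `w` of `V w = e₁`. -/
def smallWeight (M : ℕ) (α : ℝ) (L : ℕ) : Fin L → ℝ :=
  (vdm M α L)⁻¹ *ᵥ fun i => if (i : ℕ) = 0 then 1 else 0

/-- The weights `W̃_l = w_l + ⋯ + w_L`, `1 ≤ l ≤ L`. -/
def weight (M : ℕ) (α : ℝ) (L l : ℕ) : ℝ :=
  ∑ j : Fin L, if l ≤ (j : ℕ) + 1 then smallWeight M α L j else 0

/-- The structural parameters of the estimator: refinement factor `M`, weak rate `α`, strong rate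
`β`, coarsest step `h`, strong error constant `V₁`, variance of `P(X_T)`, and
`cInf = lim |c_L|^{1/L}`. -/
structure ML2RParams where
  M : ℕ
  α : ℝ
  β : ℝ
  h : ℝ
  V₁ : ℝ
  var : ℝ
  cInf : ℝ

namespace ML2RParams

variable (π : ML2RParams)

/-- `λ = √(V₁ / Var(P(X_T)))`. -/
def lam : ℝ := Real.sqrt (π.V₁ / π.var)

/-- `(1 + M^{β/2}) / √(1 + M⁻¹)`. -/
def cLow : ℝ := (1 + (π.M : ℝ) ^ (π.β / 2)) / Real.sqrt (1 + (π.M : ℝ)⁻¹)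

/-- `(1 + M^{β/2}) √(1 + M⁻¹)`. -/
def cUp : ℝ := (1 + (π.M : ℝ) ^ (π.β / 2)) * Real.sqrt (1 + (π.M : ℝ)⁻¹)

/-- The number of levels `L(ε)`. -/
def depth (ε : ℝ) : ℕ :=
  let a := 1 / 2 + Real.log (π.cInf ^ (1 / π.α) * π.h) / Real.log π.M
  ⌈a + Real.sqrt (a ^ 2 +
    2 * Real.log (Real.sqrt (1 + 4 * π.α) / ε) / (π.α * Real.log π.M))⌉₊

/-- The unnormalized allocation of level `l`. -/
def preAlloc (L l : ℕ) : ℝ :=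
  if l = 1 then 1 + π.lam * π.h ^ (π.β / 2)
  else π.lam * π.h ^ (π.β / 2) * π.cLow * |weight π.M π.α L l| *
    (π.M : ℝ) ^ (-((1 + π.β) / 2) * ((l : ℝ) - 1))

/-- The normalizing constant `q*`, for which `μ_1 + ⋯ + μ_L = 1`. -/
def qStar (L : ℕ) : ℝ := (∑ l ∈ Finset.Icc 1 L, π.preAlloc L l)⁻¹

/-- The allocation `μ_l`. -/
def alloc (L l : ℕ) : ℝ := π.qStar L * π.preAlloc L l

/-- The sample size `N(ε)`, for `L` levels. -/
def size (ε : ℝ) (L : ℕ) : ℝ :=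
  (1 + 1 / (2 * π.α * L)) *
    (π.var * (1 + π.lam * π.h ^ (π.β / 2) + π.lam * π.h ^ (π.β / 2) * π.cUp *
      ∑ l ∈ Finset.Icc 2 L, |weight π.M π.α L l| * (π.M : ℝ) ^ ((1 - π.β) / 2 * ((l : ℝ) - 1)))) /
    (ε ^ 2 * π.qStar L)

/-- The number of samples `N_l = ⌈N μ_l⌉` on level `l`. -/
def levelSize (ε : ℝ) (L l : ℕ) : ℕ := ⌈π.size ε L * π.alloc L l⌉₊

end ML2RParams

/-! ### The estimator -/

/-- `Ỹ_{l,θ}` as a function of the driving path `w`: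
`(P(X^{n_l}_{T,θ}) - P(X^{n_{l-1}}_{T,θ})) 𝒥⁻(w_T, θ) - m`, where the scheme of level `l` has
`n₀ M^{l-1}` steps. -/
def levelTerm {d q : ℕ} (Φ : ℝ → Vec d → Vec q → Vec d) (x : Vec d) (T : ℝ≥0) (n₀ M : ℕ)
    (P : Vec d → ℝ) (m : ℝ) (l : ℕ) (θ : Vec q) (w : ℝ≥0 → Vec q) : ℝ :=
  (P (schemeEnd Φ x T (n₀ * M ^ (l - 1)) θ w) - P (schemeEnd Φ x T (n₀ * M ^ (l - 2)) θ w)) *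
    girsanovMinus T (w T) θ - m

/-- `𝔼[P(X^{n_l}_T) - P(X^{n_{l-1}}_T)]`. -/
def levelMean {Ω : Type*} [MeasurableSpace Ω] {d q : ℕ} (μ : Measure Ω)
    (Φ : ℝ → Vec d → Vec q → Vec d) (x : Vec d) (T : ℝ≥0) (n₀ M : ℕ) (P : Vec d → ℝ)
    (W : ℝ≥0 → Ω → Vec q) (l : ℕ) : ℝ :=
  ∫ ω, (P (schemeEnd Φ x T (n₀ * M ^ (l - 1)) 0 (fun t => W t ω)) -
    P (schemeEnd Φ x T (n₀ * M ^ (l - 2)) 0 (fun t => W t ω))) ∂μ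

/-- The σ-algebra generated by the sample paths `j = 1, …, k` (of all levels) up to time `T`. -/
abbrev sampleHistory {Ω : Type*} {q : ℕ} (W : ℕ → ℕ → ℝ≥0 → Ω → Vec q) (T : ℝ≥0) (k : ℕ) :
    MeasurableSpace Ω :=
  ⨆ l : ℕ, ⨆ j ∈ Finset.Icc 1 k, ⨆ t ∈ Iic T, MeasurableSpace.comap (W l j t) inferInstance

/-- The weighted multilevel correction part
`∑_{l=2}^L (W̃_l / N_l) ∑_{k=1}^{N_l} Ỹ^k_{l, θ_l^{k-1}}` of the adaptive estimator with target
accuracy `ε`, where `m l` are the means of the levels and `L = L(ε)`, `N_l = N_l(ε)`. -/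
def correctionPart {Ω : Type*} {d q : ℕ} (π : ML2RParams) (ε : ℝ)
    (Φ : ℝ → Vec d → Vec q → Vec d) (x : Vec d) (T : ℝ≥0) (n₀ : ℕ) (P : Vec d → ℝ) (m : ℕ → ℝ)
    (θ : ℕ → ℕ → Ω → Vec q) (W : ℕ → ℕ → ℝ≥0 → Ω → Vec q) (ω : Ω) : ℝ :=
  ∑ l ∈ Finset.Icc 2 (π.depth ε),
    weight π.M π.α (π.depth ε) l / (π.levelSize ε (π.depth ε) l : ℝ) *
      ∑ k ∈ Finset.Icc 1 (π.levelSize ε (π.depth ε) l),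
        levelTerm Φ x T n₀ π.M P (m l) l (θ l (k - 1) ω) (fun t => W l k t ω)

end

/-!
Ordered by the sample index first, the terms of the estimator are centred given the past: each one
is a function of a new independent path and of a parameter depending on earlier paths. For such
sums the inequality `‖X + Y‖_p² ≤ ‖X‖_p² + 2 C ‖Y‖_p²`, valid when `𝔼[|X|^(p-2) X Y] = 0`, gives a
bound of Burkholder type. The change of drift of Cameron and Martin, followed by Hölder's
inequality, bounds the `L^p` norm of a term of level `l` by `κ h_l^(β/2)`, where `h_l` is its
coarser step and `κ` is uniform in `‖θ‖ ≤ c`. Finally, the allocation is chosen so that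
`∑ W̃_l² h_l^β / N_l ≤ M^β ε² / V₁`.
-/

/-! ### A Burkholder-type inequality -/

/-- The constant `C` of the expansion `|1 + t|^p ≤ 1 + p t + C (t² + |t|^p)`; the Burkholder-type
inequality below holds with `2 C`. -/
noncomputable def expansionConst (p : ℝ) : ℝ := 3 ^ p + 2 * p + p ^ 2 * Real.exp p

theorem one_le_expansionConst {p : ℝ} (hp : 1 ≤ p) : 1 ≤ expansionConst p := by
  have h₁ : (0 : ℝ) ≤ 3 ^ p := by positivity
  have h₂ : 0 ≤ p ^ 2 * Real.exp p := by positivity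
  unfold expansionConst
  linarith

theorem exp_le_one_add_add_sq_mul_exp_abs (x : ℝ) :
    Real.exp x ≤ 1 + x + x ^ 2 * Real.exp |x| := by
  have h_neg := Real.add_one_le_exp (-x)
  have h_mul : Real.exp x * Real.exp (-x) = 1 := by rw [← Real.exp_add]; simp
  have h_first : Real.exp x - 1 ≤ x * Real.exp x := by nlinarith [Real.exp_pos x]
  rcases le_total 0 x with hx | hx
  · rw [abs_of_nonneg hx]
    nlinarith [mul_le_mul_of_nonneg_left h_first hx]
  · nlinarith [Real.add_one_le_exp x,
      mul_le_mul_of_nonneg_left (Real.one_le_exp (abs_nonneg x)) (sq_nonneg x)]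

theorem abs_one_add_rpow_le_of_abs_le_half {p t : ℝ} (hp : 0 ≤ p) (ht : |t| ≤ 1 / 2) :
    |1 + t| ^ p ≤ 1 + p * t + p ^ 2 * Real.exp p * t ^ 2 := by
  have hpos : 0 < 1 + t := by linarith [(abs_le.1 ht).1]
  have hexp : Real.exp |p * t| ≤ Real.exp p := by
    rw [abs_mul, abs_of_nonneg hp]
    exact Real.exp_le_exp.2 (mul_le_of_le_one_right hp (by linarith))
  calc |1 + t| ^ p ≤ Real.exp t ^ p := by
        rw [abs_of_pos hpos]
        exact Real.rpow_le_rpow hpos.le (by linarith [Real.add_one_le_exp t]) hp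
    _ = Real.exp (p * t) := by rw [mul_comm, Real.exp_mul]
    _ ≤ 1 + p * t + (p * t) ^ 2 * Real.exp |p * t| := exp_le_one_add_add_sq_mul_exp_abs _
    _ ≤ 1 + p * t + (p * t) ^ 2 * Real.exp p := by gcongr
    _ = 1 + p * t + p ^ 2 * Real.exp p * t ^ 2 := by ring

theorem abs_one_add_rpow_le_of_half_le_abs {p t : ℝ} (hp : 0 ≤ p) (ht : 1 / 2 ≤ |t|) :
    |1 + t| ^ p ≤ 1 + p * t + (2 * p * t ^ 2 + 3 ^ p * |t| ^ p) := by
  have h_abs : |1 + t| ≤ 3 * |t| := by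
    have := abs_add_le 1 t
    rw [abs_one] at this
    linarith
  have h_rpow : |1 + t| ^ p ≤ 3 ^ p * |t| ^ p := by
    rw [← Real.mul_rpow (by norm_num) (abs_nonneg t)]
    exact Real.rpow_le_rpow (abs_nonneg _) h_abs hp
  have h_linear : -t ≤ 2 * t ^ 2 := by
    have := neg_le_abs t
    rw [← sq_abs]
    nlinarith
  nlinarith [h_rpow]

theorem abs_one_add_rpow_le {p : ℝ} (hp : 0 ≤ p) (t : ℝ) :
    |1 + t| ^ p ≤ 1 + p * t + expansionConst p * (t ^ 2 + |t| ^ p) := by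
  unfold expansionConst
  rcases le_total |t| (1 / 2) with ht | ht
  · have h_rest : 0 ≤ (3 ^ p + 2 * p) * (t ^ 2 + |t| ^ p) + p ^ 2 * Real.exp p * |t| ^ p := by
      positivity
    linarith [abs_one_add_rpow_le_of_abs_le_half hp ht]
  · have h_rest : 0 ≤ 3 ^ p * t ^ 2 + 2 * p * |t| ^ p
        + p ^ 2 * Real.exp p * (t ^ 2 + |t| ^ p) := by positivity
    linarith [abs_one_add_rpow_le_of_half_le_abs hp ht]

theorem abs_add_rpow_le {p : ℝ} (hp : 1 ≤ p) (x y : ℝ) :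
    |x + y| ^ p ≤ |x| ^ p + p * (|x| ^ (p - 2) * x * y)
      + expansionConst p * (|x| ^ (p - 2) * y ^ 2 + |y| ^ p) := by
  have hC := one_le_expansionConst hp
  rcases eq_or_ne x 0 with rfl | hx
  · have h_sq : 0 ≤ |(0 : ℝ)| ^ (p - 2) * y ^ 2 := by positivity
    have h_rpow : 0 ≤ |y| ^ p := by positivity
    simp only [zero_add, abs_zero, Real.zero_rpow (by linarith : p ≠ 0), mul_zero, zero_mul] at *
    nlinarith
  obtain ⟨t, rfl⟩ : ∃ t, y = x * t := ⟨y / x, by field_simp⟩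
  have h_sq : |x| ^ p = |x| ^ (p - 2) * x ^ 2 := by
    rw [← sq_abs x, ← Real.rpow_natCast |x| 2, ← Real.rpow_add (abs_pos.2 hx)]
    norm_num
  calc |x + x * t| ^ p = |x| ^ p * |1 + t| ^ p := by
        rw [← Real.mul_rpow (abs_nonneg _) (abs_nonneg _), ← abs_mul, mul_one_add]
    _ ≤ |x| ^ p * (1 + p * t + expansionConst p * (t ^ 2 + |t| ^ p)) := by
        gcongr
        exact abs_one_add_rpow_le (by linarith) t
    _ = |x| ^ p + p * (|x| ^ p * t) + expansionConst p * (|x| ^ p * t ^ 2 + |x| ^ p * |t| ^ p) := by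
        ring
    _ = _ := by
        rw [abs_mul, Real.mul_rpow (abs_nonneg _) (abs_nonneg _), h_sq]
        ring

theorem rpow_add_mul_rpow_le_add_rpow {s a u : ℝ} (hs : 1 ≤ s) (ha : 0 ≤ a) (hu : 0 ≤ u) :
    a ^ s + s * (a ^ (s - 1) * u) ≤ (a + u) ^ s := by
  rcases hs.eq_or_lt with rfl | hs'
  · simp
  rcases ha.eq_or_lt with rfl | ha'
  · rw [Real.zero_rpow (by linarith), Real.zero_rpow (by linarith)]
    simp only [zero_mul, mul_zero, add_zero, zero_add]
    positivity
  calc a ^ s + s * (a ^ (s - 1) * u) = a ^ s * (1 + s * (u / a)) := by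
        rw [Real.rpow_sub_one ha'.ne']
        field_simp
    _ ≤ a ^ s * (1 + u / a) ^ s := by
        gcongr
        exact one_add_mul_self_le_rpow_one_add (by linarith [div_nonneg hu ha]) hs
    _ = (a + u) ^ s := by
        rw [← Real.mul_rpow ha (by positivity), mul_add, mul_one, mul_div_cancel₀ _ ha'.ne']

theorem rpow_add_mul_add_le_rpow {s a b C : ℝ} (hs : 1 ≤ s) (ha : 0 ≤ a) (hb : 0 ≤ b)
    (hC : 1 ≤ C) :
    a ^ s + C * (a ^ (s - 1) * b + b ^ s) ≤ (a + 2 * C * b) ^ s := by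
  have hu : 0 ≤ 2 * C * b := by positivity
  have h_bernoulli := rpow_add_mul_rpow_le_add_rpow hs ha hu
  have h_superadd := Real.add_rpow_le_rpow_add ha hu hs
  have h_scale : 2 * C * b ^ s ≤ (2 * C * b) ^ s := by
    rw [Real.mul_rpow (by positivity) hb]
    gcongr
    exact Real.self_le_rpow_of_one_le (by linarith) hs
  have h_drop : 1 * (a ^ (s - 1) * (2 * C * b)) ≤ s * (a ^ (s - 1) * (2 * C * b)) := by gcongr
  nlinarith

section Moments

variable {Ω : Type*} [MeasurableSpace Ω] {μ : Measure Ω} {p : ℝ}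

theorem eLpNorm_rpow_eq_lintegral (hp : 0 < p) (X : Ω → ℝ) :
    eLpNorm X (ENNReal.ofReal p) μ ^ p = ∫⁻ ω, ‖X ω‖ₑ ^ p ∂μ := by
  rw [eLpNorm_eq_lintegral_rpow_enorm_toReal (by simpa using hp) ENNReal.ofReal_ne_top,
    ENNReal.toReal_ofReal hp.le, one_div, ENNReal.rpow_inv_rpow hp.ne']

theorem lpNorm_rpow_eq_integral (hp : 0 < p) {X : Ω → ℝ} (hX : AEStronglyMeasurable X μ) :
    lpNorm X (ENNReal.ofReal p) μ ^ p = ∫ ω, |X ω| ^ p ∂μ := by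
  rw [lpNorm_eq_integral_norm_rpow_toReal (by simpa using hp) ENNReal.ofReal_ne_top hX,
    ENNReal.toReal_ofReal hp.le, Real.rpow_inv_rpow (by positivity) hp.ne']
  rfl

theorem integrable_abs_rpow_of_memLp (hp : 0 < p) {X : Ω → ℝ}
    (hX : MemLp X (ENNReal.ofReal p) μ) : Integrable (fun ω => |X ω| ^ p) μ := by
  have := hX.integrable_norm_rpow (by simpa using hp) ENNReal.ofReal_ne_top
  simpa only [ENNReal.toReal_ofReal hp.le, Real.norm_eq_abs] using this

theorem rpow_mul_rpow_le_add {x y s t : ℝ} (hx : 0 ≤ x) (hy : 0 ≤ y) (hs : 0 ≤ s) (ht : 0 ≤ t) :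
    x ^ s * y ^ t ≤ x ^ (s + t) + y ^ (s + t) := by
  have h_max : 0 ≤ max x y := le_max_of_le_left hx
  calc x ^ s * y ^ t ≤ max x y ^ s * max x y ^ t := by
        gcongr
        exacts [le_max_left x y, le_max_right x y]
    _ = max x y ^ (s + t) := (Real.rpow_add_of_nonneg h_max hs ht).symm
    _ ≤ x ^ (s + t) + y ^ (s + t) := by
        rcases max_choice x y with h | h <;> rw [h]
        · exact le_add_of_nonneg_right (Real.rpow_nonneg hy _)
        · exact le_add_of_nonneg_left (Real.rpow_nonneg hx _)

theorem integrable_abs_rpow_mul_abs_rpow {s t : ℝ} (hs : 0 ≤ s) (ht : 0 ≤ t) (hst : 0 < s + t)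
    {X Y : Ω → ℝ} (hX : MemLp X (ENNReal.ofReal (s + t)) μ)
    (hY : MemLp Y (ENNReal.ofReal (s + t)) μ) :
    Integrable (fun ω => |X ω| ^ s * |Y ω| ^ t) μ := by
  have hXm := hX.1.aemeasurable
  have hYm := hY.1.aemeasurable
  refine ((integrable_abs_rpow_of_memLp hst hX).add (integrable_abs_rpow_of_memLp hst hY)).mono'
    (AEMeasurable.aestronglyMeasurable (by fun_prop)) (.of_forall fun ω => ?_)
  rw [Real.norm_of_nonneg (by positivity)]
  exact rpow_mul_rpow_le_add (abs_nonneg _) (abs_nonneg _) hs ht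

theorem integral_abs_rpow_mul_abs_rpow_le {s t : ℝ} (hs : 0 ≤ s) (ht : 0 ≤ t) (hst : 0 < s + t)
    {X Y : Ω → ℝ} (hX : MemLp X (ENNReal.ofReal (s + t)) μ)
    (hY : MemLp Y (ENNReal.ofReal (s + t)) μ) :
    ∫ ω, |X ω| ^ s * |Y ω| ^ t ∂μ
      ≤ lpNorm X (ENNReal.ofReal (s + t)) μ ^ s * lpNorm Y (ENNReal.ofReal (s + t)) μ ^ t := by
  have hXm := hX.1.aemeasurable
  have hYm := hY.1.aemeasurable
  have h_root {a u : ℝ} (ha : 0 ≤ a) (hu : 0 ≤ u) :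
      ENNReal.ofReal (a ^ (s + t)) ^ (u / (s + t)) = ENNReal.ofReal (a ^ u) := by
    rw [ENNReal.ofReal_rpow_of_nonneg (by positivity) (by positivity), ← Real.rpow_mul ha,
      mul_div_cancel₀ _ hst.ne']
  have h_norm {Z : Ω → ℝ} (hZ : MemLp Z (ENNReal.ofReal (s + t)) μ) :
      ∫⁻ ω, ENNReal.ofReal (|Z ω| ^ (s + t)) ∂μ
        = ENNReal.ofReal (lpNorm Z (ENNReal.ofReal (s + t)) μ ^ (s + t)) := by
    rw [lpNorm_rpow_eq_integral hst hZ.1, ofReal_integral_eq_lintegral_ofReal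
      (integrable_abs_rpow_of_memLp hst hZ) (.of_forall fun ω => by positivity)]
  have h_holder := ENNReal.lintegral_mul_norm_pow_le (μ := μ)
    (f := fun ω => ENNReal.ofReal (|X ω| ^ (s + t)))
    (g := fun ω => ENNReal.ofReal (|Y ω| ^ (s + t))) (by fun_prop) (by fun_prop)
    (by positivity : 0 ≤ s / (s + t)) (by positivity : 0 ≤ t / (s + t)) (by field_simp)
  simp only [h_norm hX, h_norm hY, h_root (abs_nonneg _) hs, h_root (abs_nonneg _) ht,
    h_root lpNorm_nonneg hs, h_root lpNorm_nonneg ht] at h_holder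
  have h_nonneg : 0 ≤ lpNorm X (ENNReal.ofReal (s + t)) μ ^ s := Real.rpow_nonneg lpNorm_nonneg s
  rw [← ENNReal.ofReal_mul h_nonneg] at h_holder
  rw [integral_eq_lintegral_of_nonneg_ae (.of_forall fun ω => by positivity)
    (AEMeasurable.aestronglyMeasurable (by fun_prop))]
  refine ENNReal.toReal_le_of_le_ofReal
    (mul_nonneg h_nonneg (Real.rpow_nonneg lpNorm_nonneg t)) (le_trans (le_of_eq ?_) h_holder)
  exact lintegral_congr fun ω => ENNReal.ofReal_mul (by positivity)

theorem integrable_abs_rpow_mul_sq (hp : 2 ≤ p) {X Y : Ω → ℝ}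
    (hX : MemLp X (ENNReal.ofReal p) μ) (hY : MemLp Y (ENNReal.ofReal p) μ) :
    Integrable (fun ω => |X ω| ^ (p - 2) * Y ω ^ 2) μ := by
  rw [← sub_add_cancel p 2] at hX hY
  simpa using integrable_abs_rpow_mul_abs_rpow (by linarith) zero_le_two (by linarith) hX hY

theorem integrable_abs_rpow_mul_mul (hp : 1 ≤ p) {X Y : Ω → ℝ}
    (hX : MemLp X (ENNReal.ofReal p) μ) (hY : MemLp Y (ENNReal.ofReal p) μ) :
    Integrable (fun ω => |X ω| ^ (p - 2) * X ω * Y ω) μ := by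
  have hXm := hX.1.aemeasurable
  have hYm := hY.1.aemeasurable
  rw [← sub_add_cancel p 1] at hX hY
  refine (integrable_abs_rpow_mul_abs_rpow (by linarith) zero_le_one (by linarith) hX hY).mono'
    (AEMeasurable.aestronglyMeasurable (by fun_prop)) (.of_forall fun ω => ?_)
  rcases eq_or_ne (X ω) 0 with hx | hx
  · simp only [hx, mul_zero, zero_mul, norm_zero]
    positivity
  · rw [norm_mul, norm_mul, Real.norm_of_nonneg (by positivity), Real.norm_eq_abs,
      Real.norm_eq_abs, Real.rpow_one, ← Real.rpow_add_one (abs_ne_zero.2 hx)]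
    ring_nf
    exact le_rfl

theorem lpNorm_add_rpow_le (hp : 2 ≤ p) {X Y : Ω → ℝ} (hX : MemLp X (ENNReal.ofReal p) μ)
    (hY : MemLp Y (ENNReal.ofReal p) μ)
    (h_orth : ∫ ω, |X ω| ^ (p - 2) * X ω * Y ω ∂μ = 0) :
    lpNorm (X + Y) (ENNReal.ofReal p) μ ^ p ≤ lpNorm X (ENNReal.ofReal p) μ ^ p
      + expansionConst p * (lpNorm X (ENNReal.ofReal p) μ ^ (p - 2)
        * lpNorm Y (ENNReal.ofReal p) μ ^ 2 + lpNorm Y (ENNReal.ofReal p) μ ^ p) := by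
  have hp0 : 0 < p := by linarith
  have hX_int := integrable_abs_rpow_of_memLp hp0 hX
  have hY_int := integrable_abs_rpow_of_memLp hp0 hY
  have h_sq_int := integrable_abs_rpow_mul_sq hp hX hY
  have h_mul_int := (integrable_abs_rpow_mul_mul (by linarith) hX hY).const_mul p
  have h_main_int : Integrable (fun ω => |X ω| ^ p + p * (|X ω| ^ (p - 2) * X ω * Y ω)) μ :=
    hX_int.add h_mul_int
  have h_rest_int : Integrable (fun ω => expansionConst p * (|X ω| ^ (p - 2) * Y ω ^ 2 + |Y ω| ^ p))
      μ := (h_sq_int.add hY_int).const_mul _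
  have h_holder : ∫ ω, |X ω| ^ (p - 2) * Y ω ^ 2 ∂μ
      ≤ lpNorm X (ENNReal.ofReal p) μ ^ (p - 2) * lpNorm Y (ENNReal.ofReal p) μ ^ 2 := by
    simpa using integral_abs_rpow_mul_abs_rpow_le (s := p - 2) (t := 2) (by linarith) zero_le_two
      (by linarith) (by simpa using hX) (by simpa using hY)
  calc lpNorm (X + Y) (ENNReal.ofReal p) μ ^ p = ∫ ω, |X ω + Y ω| ^ p ∂μ :=
        lpNorm_rpow_eq_integral hp0 (hX.add hY).1
    _ ≤ ∫ ω, (|X ω| ^ p + p * (|X ω| ^ (p - 2) * X ω * Y ω)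
          + expansionConst p * (|X ω| ^ (p - 2) * Y ω ^ 2 + |Y ω| ^ p)) ∂μ :=
        integral_mono (integrable_abs_rpow_of_memLp hp0 (hX.add hY)) (h_main_int.add h_rest_int)
          fun ω => abs_add_rpow_le (by linarith) _ _
    _ = lpNorm X (ENNReal.ofReal p) μ ^ p + expansionConst p
          * (∫ ω, |X ω| ^ (p - 2) * Y ω ^ 2 ∂μ + lpNorm Y (ENNReal.ofReal p) μ ^ p) := by
        rw [integral_add h_main_int h_rest_int, integral_add hX_int h_mul_int, integral_const_mul,
          h_orth, integral_const_mul, integral_add h_sq_int hY_int,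
          lpNorm_rpow_eq_integral hp0 hX.1, lpNorm_rpow_eq_integral hp0 hY.1, mul_zero, add_zero]
    _ ≤ _ := by
        have := one_le_expansionConst (p := p) (by linarith)
        gcongr

theorem lpNorm_add_sq_le (hp : 2 ≤ p) {X Y : Ω → ℝ} (hX : MemLp X (ENNReal.ofReal p) μ)
    (hY : MemLp Y (ENNReal.ofReal p) μ)
    (h_orth : ∫ ω, |X ω| ^ (p - 2) * X ω * Y ω ∂μ = 0) :
    lpNorm (X + Y) (ENNReal.ofReal p) μ ^ 2 ≤ lpNorm X (ENNReal.ofReal p) μ ^ 2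
      + 2 * expansionConst p * lpNorm Y (ENNReal.ofReal p) μ ^ 2 := by
  have hC := one_le_expansionConst (p := p) (by linarith)
  have h_moment := lpNorm_add_rpow_le hp hX hY h_orth
  set a := lpNorm X (ENNReal.ofReal p) μ
  set b := lpNorm Y (ENNReal.ofReal p) μ
  have ha : 0 ≤ a := lpNorm_nonneg
  have hb : 0 ≤ b := lpNorm_nonneg
  have h_pow {u s : ℝ} (hu : 0 ≤ u) : (u ^ 2) ^ (s / 2) = u ^ s := by
    rw [← Real.rpow_natCast_mul hu, Nat.cast_two, mul_div_cancel₀ s two_ne_zero]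
  refine (Real.rpow_le_rpow_iff (sq_nonneg _) (by positivity) (by linarith : 0 < p / 2)).1 ?_
  calc (lpNorm (X + Y) (ENNReal.ofReal p) μ ^ 2) ^ (p / 2)
      = lpNorm (X + Y) (ENNReal.ofReal p) μ ^ p := h_pow lpNorm_nonneg
    _ ≤ a ^ p + expansionConst p * (a ^ (p - 2) * b ^ 2 + b ^ p) := h_moment
    _ = (a ^ 2) ^ (p / 2) + expansionConst p
          * ((a ^ 2) ^ (p / 2 - 1) * b ^ 2 + (b ^ 2) ^ (p / 2)) := by
        rw [h_pow ha, h_pow hb, show p / 2 - 1 = (p - 2) / 2 by ring, h_pow ha]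
    _ ≤ _ := rpow_add_mul_add_le_rpow (by linarith) (sq_nonneg a) (sq_nonneg b) hC

theorem lpNorm_sum_sq_le (hp : 2 ≤ p) {ι : Type*} [LinearOrder ι] (s : Finset ι) {D : ι → Ω → ℝ}
    (hD : ∀ i ∈ s, MemLp (D i) (ENNReal.ofReal p) μ)
    (h_orth : ∀ i ∈ s, ∫ ω, |∑ j ∈ s with j < i, D j ω| ^ (p - 2) *
      (∑ j ∈ s with j < i, D j ω) * D i ω ∂μ = 0) :
    lpNorm (∑ i ∈ s, D i) (ENNReal.ofReal p) μ ^ 2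
      ≤ 2 * expansionConst p * ∑ i ∈ s, lpNorm (D i) (ENNReal.ofReal p) μ ^ 2 := by
  induction s using Finset.induction_on_max with
  | empty => simp
  | insert i s hi ih =>
    have his : i ∉ s := fun h => lt_irrefl i (hi i h)
    rw [Finset.forall_mem_insert] at hD h_orth
    have h_before : {j ∈ insert i s | j < i} = s := by
      rw [Finset.filter_insert, if_neg (lt_irrefl i), Finset.filter_true_of_mem hi]
    have h_prefix (k : ι) (hk : k ∈ s) : {j ∈ insert i s | j < k} = {j ∈ s | j < k} := by
      rw [Finset.filter_insert, if_neg (hi k hk).le.not_gt]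
    rw [Finset.sum_insert his, Finset.sum_insert his, add_comm (D i), mul_add, add_comm (_ * _)]
    refine (lpNorm_add_sq_le hp (memLp_finsetSum' s hD.2) hD.1 ?_).trans ?_
    · simpa only [h_before, Finset.sum_apply] using h_orth.1
    · gcongr
      exact ih hD.2 fun k hk => by simpa only [h_prefix k hk] using h_orth.2 k hk

end Moments

/-! ### Sums of independent samples with adaptive parameters -/

section Independence

variable {Ω G E : Type*} [MeasurableSpace Ω] [MeasurableSpace G] [MeasurableSpace E]
  {μ : Measure Ω} [IsProbabilityMeasure μ] {A : Ω → G} {Z : Ω → E}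

theorem lintegral_comp_indepFun (hA : Measurable A) (hZ : Measurable Z) (hAZ : IndepFun A Z μ)
    {f : G × E → ℝ≥0∞} (hf : Measurable f) :
    ∫⁻ ω, f (A ω, Z ω) ∂μ = ∫⁻ ω, ∫⁻ ω', f (A ω, Z ω') ∂μ ∂μ := by
  have := Measure.isProbabilityMeasure_map (μ := μ) hZ.aemeasurable
  rw [← lintegral_map hf (hA.prodMk hZ),
    hAZ.map_prod_eq_prod_map_map hA.aemeasurable hZ.aemeasurable, lintegral_prod _ hf.aemeasurable,
    lintegral_map hf.lintegral_prod_right' hA]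
  exact lintegral_congr fun ω => lintegral_map (hf.comp measurable_prodMk_left) hZ

theorem integral_comp_indepFun (hA : Measurable A) (hZ : Measurable Z) (hAZ : IndepFun A Z μ)
    {f : G × E → ℝ} (hf : Measurable f) (hf_int : Integrable (fun ω => f (A ω, Z ω)) μ) :
    ∫ ω, f (A ω, Z ω) ∂μ = ∫ ω, ∫ ω', f (A ω, Z ω') ∂μ ∂μ := by
  have := Measure.isProbabilityMeasure_map (μ := μ) hA.aemeasurable
  have := Measure.isProbabilityMeasure_map (μ := μ) hZ.aemeasurable
  have h_law := hAZ.map_prod_eq_prod_map_map hA.aemeasurable hZ.aemeasurable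
  have h_prod : Integrable f ((μ.map A).prod (μ.map Z)) := by
    rw [← h_law]
    exact (integrable_map_measure hf.aestronglyMeasurable (hA.prodMk hZ).aemeasurable).2 hf_int
  rw [← integral_map (hA.prodMk hZ).aemeasurable hf.aestronglyMeasurable, h_law,
    integral_prod _ h_prod, integral_map hA.aemeasurable
      hf.stronglyMeasurable.integral_prod_right'.aestronglyMeasurable]
  exact integral_congr_ae (.of_forall fun ω => integral_map hZ.aemeasurable
    (hf.comp measurable_prodMk_left).aestronglyMeasurable)

theorem eLpNorm_comp_indepFun_le (hA : Measurable A) (hZ : Measurable Z) (hAZ : IndepFun A Z μ)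
    {f : G × E → ℝ} (hf : Measurable f) {p : ℝ} (hp : 0 < p) {B : ℝ≥0∞}
    (hB : ∀ ω, eLpNorm (fun ω' => f (A ω, Z ω')) (ENNReal.ofReal p) μ ≤ B) :
    eLpNorm (fun ω => f (A ω, Z ω)) (ENNReal.ofReal p) μ ≤ B := by
  rw [← ENNReal.rpow_le_rpow_iff hp, eLpNorm_rpow_eq_lintegral hp,
    lintegral_comp_indepFun hA hZ hAZ (f := fun y => ‖f y‖ₑ ^ p) (by fun_prop)]
  calc ∫⁻ ω, ∫⁻ ω', ‖f (A ω, Z ω')‖ₑ ^ p ∂μ ∂μ ≤ ∫⁻ _, B ^ p ∂μ := by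
        gcongr with ω
        rw [← eLpNorm_rpow_eq_lintegral hp]
        gcongr
        exact hB ω
    _ = B ^ p := by simp

end Independence

section AdaptiveSum

variable {Ω ι G E : Type*} [LinearOrder ι] [MeasurableSpace G] [mE : MeasurableSpace E]
  {Z : ι → Ω → E} {i : ι}

/-- The σ-algebra of the past of `i`, generated by the samples `Z j` with `j < i`. -/
abbrev pastAlgebra (Z : ι → Ω → E) (i : ι) : MeasurableSpace Ω := ⨆ j ∈ Iio i, mE.comap (Z j)

theorem measurable_pastAlgebra {j : ι} (hj : j < i) : Measurable[pastAlgebra Z i] (Z j) :=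
  measurable_iff_comap_le.2 (le_iSup₂_of_le j hj le_rfl)

theorem pastAlgebra_mono : Monotone (pastAlgebra Z) := fun _ _ hij =>
  biSup_mono fun _ hk => lt_of_lt_of_le hk hij

variable [mΩ : MeasurableSpace Ω] {μ : Measure Ω}

theorem pastAlgebra_le (hZ : ∀ i, Measurable (Z i)) (i : ι) : pastAlgebra Z i ≤ mΩ :=
  iSup₂_le fun j _ => (hZ j).comap_le

theorem indepFun_of_measurable_pastAlgebra (hZ : ∀ i, Measurable (Z i)) (hZ_ind : iIndepFun Z μ)
    {A : Ω → G} (hA : Measurable[pastAlgebra Z i] A) : IndepFun A (Z i) μ := by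
  have h := indep_iSup_of_disjoint (fun j => (hZ j).comap_le)
    ((iIndepFun_iff_iIndep _ _ _).1 hZ_ind) (S := Iio i) (T := {i})
    (disjoint_singleton_right.2 (lt_irrefl i))
  rw [iSup_singleton] at h
  exact indep_of_indep_of_le_left h hA.comap_le

theorem lpNorm_adaptive_sum_sq_le [IsProbabilityMeasure μ] {p : ℝ} (hp : 2 ≤ p)
    (hZ : ∀ i, Measurable (Z i)) (hZ_ind : iIndepFun Z μ) (s : Finset ι) {A : ι → Ω → G}
    (hA : ∀ i ∈ s, Measurable[pastAlgebra Z i] (A i)) {F : ι → G × E → ℝ}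
    (hF : ∀ i ∈ s, Measurable (F i)) {b : ι → ℝ} (hb : ∀ i ∈ s, 0 ≤ b i)
    (hF_zero : ∀ i ∈ s, ∀ ω, ∫ ω', F i (A i ω, Z i ω') ∂μ = 0)
    (hF_le : ∀ i ∈ s, ∀ ω,
      eLpNorm (fun ω' => F i (A i ω, Z i ω')) (ENNReal.ofReal p) μ ≤ ENNReal.ofReal (b i)) :
    MemLp (∑ i ∈ s, fun ω => F i (A i ω, Z i ω)) (ENNReal.ofReal p) μ ∧
    lpNorm (∑ i ∈ s, fun ω => F i (A i ω, Z i ω)) (ENNReal.ofReal p) μ ^ 2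
      ≤ 2 * expansionConst p * ∑ i ∈ s, b i ^ 2 := by
  have hA_meas (i) (hi : i ∈ s) : Measurable (A i) := (hA i hi).mono (pastAlgebra_le hZ i) le_rfl
  have hD_le (i) (hi : i ∈ s) : eLpNorm (fun ω => F i (A i ω, Z i ω)) (ENNReal.ofReal p) μ
      ≤ ENNReal.ofReal (b i) :=
    eLpNorm_comp_indepFun_le (hA_meas i hi) (hZ i)
      (indepFun_of_measurable_pastAlgebra hZ hZ_ind (hA i hi)) (hF i hi)
      (by linarith) (hF_le i hi)
  have hD (i) (hi : i ∈ s) : MemLp (fun ω => F i (A i ω, Z i ω)) (ENNReal.ofReal p) μ :=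
    ⟨((hF i hi).comp ((hA_meas i hi).prodMk (hZ i))).aestronglyMeasurable,
      (hD_le i hi).trans_lt ENNReal.ofReal_lt_top⟩
  refine ⟨memLp_finsetSum' s hD, (lpNorm_sum_sq_le hp s hD fun i hi => ?_).trans ?_⟩
  · set S : Ω → ℝ := fun ω => ∑ j ∈ s with j < i, F j (A j ω, Z j ω)
    have hS : Measurable[pastAlgebra Z i] S := by
      refine Finset.measurable_fun_sum _ fun j hj => ?_
      obtain ⟨hjs, hji⟩ := Finset.mem_filter.1 hj
      exact (hF j hjs).comp (((hA j hjs).mono (pastAlgebra_mono hji.le) le_rfl).prodMk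
        (measurable_pastAlgebra hji))
    have hFi := hF i hi
    have h_int := integrable_abs_rpow_mul_mul (by linarith)
      (memLp_finsetSum {j ∈ s | j < i} fun j hj => hD j (Finset.mem_of_mem_filter j hj)) (hD i hi)
    rw [integral_comp_indepFun ((hS.mono (pastAlgebra_le hZ i) le_rfl).prodMk (hA_meas i hi)) (hZ i)
      (indepFun_of_measurable_pastAlgebra hZ hZ_ind (hS.prodMk (hA i hi)))
      (f := fun y => |y.1.1| ^ (p - 2) * y.1.1 * F i (y.1.2, y.2)) (by fun_prop) h_int]
    simp only [integral_const_mul, hF_zero i hi, mul_zero, integral_zero]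
  · have := one_le_expansionConst (p := p) (by linarith)
    gcongr with i hi
    · exact lpNorm_nonneg
    rw [← toReal_eLpNorm (hD i hi).1]
    exact ENNReal.toReal_le_of_le_ofReal (hb i hi) (hD_le i hi)

end AdaptiveSum

/-! ### Cameron–Martin for centred Gaussian products -/

theorem pi_withDensity_prod {ι : Type*} [Fintype ι] {E : ι → Type*} [∀ i, MeasurableSpace (E i)]
    (ν : ∀ i, Measure (E i)) [∀ i, IsProbabilityMeasure (ν i)] {g : ∀ i, E i → ℝ≥0∞}
    (hg : ∀ i, Measurable (g i)) [∀ i, SigmaFinite ((ν i).withDensity (g i))] :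
    (Measure.pi ν).withDensity (fun x => ∏ i, g i (x i)) =
      Measure.pi (fun i => (ν i).withDensity (g i)) := by
  refine (Measure.pi_eq fun s hs => ?_).symm
  have h_ind : ∀ i, Measurable ((s i).indicator (g i)) := fun i => (hg i).indicator (hs i)
  have h_prod : (univ.pi s).indicator (fun x => ∏ i, g i (x i)) =
      fun x => ∏ i, (s i).indicator (g i) (x i) := by
    ext x
    by_cases hx : x ∈ univ.pi s
    · rw [indicator_of_mem hx]
      exact Finset.prod_congr rfl fun i _ => (indicator_of_mem (hx i (mem_univ i)) _).symm
    · rw [indicator_of_notMem hx]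
      simp only [Set.mem_pi, mem_univ, true_imp_iff, not_forall] at hx
      obtain ⟨i, hi⟩ := hx
      exact (Finset.prod_eq_zero (Finset.mem_univ i) (indicator_of_notMem hi _)).symm
  rw [withDensity_apply _ (.univ_pi hs), ← lintegral_indicator (.univ_pi hs), h_prod,
    lintegral_prod_eq_prod_lintegral_of_indepFun Finset.univ
      (fun i (x : ∀ i, E i) => (s i).indicator (g i) (x i))
      (iIndepFun_pi fun i => (h_ind i).aemeasurable)
      (fun i => (h_ind i).comp (measurable_pi_apply i))]
  refine Finset.prod_congr rfl fun i _ => ?_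
  rw [withDensity_apply _ (hs i), ← lintegral_indicator (hs i),
    (measurePreserving_eval ν i).lintegral_comp (h_ind i)]

theorem gaussianReal_withDensity_exp {v : ℝ≥0} (hv : v ≠ 0) (a : ℝ) :
    (gaussianReal 0 v).withDensity
      (fun x => ENNReal.ofReal (Real.exp (-(a * x) - v * (a * a) / 2))) =
      gaussianReal (-(v * a)) v := by
  have hv' : (v : ℝ) ≠ 0 := NNReal.coe_ne_zero.2 hv
  rw [gaussianReal_of_var_ne_zero _ hv, gaussianReal_of_var_ne_zero _ hv,
    ← withDensity_mul _ (measurable_gaussianPDF _ _) (by fun_prop)]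
  congr 1
  ext x
  rw [Pi.mul_apply, gaussianPDF, gaussianPDF, ← ENNReal.ofReal_mul (gaussianPDFReal_nonneg _ _ _),
    gaussianPDFReal, gaussianPDFReal, mul_assoc, ← Real.exp_add]
  congr 3
  field_simp
  ring

section GaussianProduct

variable {ι : Type*} [Fintype ι]

/-- The law of a family, indexed by `ι`, of independent centred Gaussian variables of variance
`v`. -/
noncomputable abbrev gaussianProduct (ι : Type*) [Fintype ι] (v : ℝ≥0) : Measure (ι → ℝ) :=
  Measure.pi fun _ => gaussianReal 0 v

/-- The density with respect to `gaussianProduct ι v` of its translate by `-v • a`; for the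
increments of a Brownian motion over steps of length `v` this is Girsanov's density. -/
noncomputable def shiftDensity (v : ℝ≥0) (a z : ι → ℝ) : ℝ :=
  Real.exp (-(a ⬝ᵥ z) - v * (a ⬝ᵥ a) / 2)

theorem shiftDensity_pos (v : ℝ≥0) (a z : ι → ℝ) : 0 < shiftDensity v a z := Real.exp_pos _

@[fun_prop]
theorem measurable_shiftDensity (v : ℝ≥0) (a : ι → ℝ) : Measurable (shiftDensity v a) := by
  unfold shiftDensity dotProduct
  fun_prop

theorem shiftDensity_eq_prod (v : ℝ≥0) (a z : ι → ℝ) :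
    shiftDensity v a z = ∏ i, Real.exp (-(a i * z i) - v * (a i * a i) / 2) := by
  rw [← Real.exp_sum, Finset.sum_sub_distrib, Finset.sum_neg_distrib, ← Finset.sum_div,
    ← Finset.mul_sum, shiftDensity, dotProduct, dotProduct]

theorem shiftDensity_rpow (v : ℝ≥0) (a z : ι → ℝ) (k : ℝ) :
    shiftDensity v a z ^ k =
      shiftDensity v (k • a) z * Real.exp (k * (k - 1) * (v * (a ⬝ᵥ a) / 2)) := by
  simp only [shiftDensity, ← Real.exp_mul, ← Real.exp_add, smul_dotProduct, dotProduct_smul,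
    smul_eq_mul]
  ring_nf

theorem gaussianProduct_withDensity_shiftDensity {v : ℝ≥0} (hv : v ≠ 0) (a : ι → ℝ) :
    (gaussianProduct ι v).withDensity (fun z => ENNReal.ofReal (shiftDensity v a z)) =
      Measure.pi fun i => gaussianReal (-(v * a i)) v := by
  have h_factor i := gaussianReal_withDensity_exp hv (a i)
  have (i : ι) : SigmaFinite ((gaussianReal 0 v).withDensity
      fun x => ENNReal.ofReal (Real.exp (-(a i * x) - v * (a i * a i) / 2))) := by
    rw [h_factor i]
    infer_instance
  simp only [shiftDensity_eq_prod, ENNReal.ofReal_prod_of_nonneg fun _ _ => (Real.exp_pos _).le]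
  rw [gaussianProduct, pi_withDensity_prod _ (g := fun i x =>
    ENNReal.ofReal (Real.exp (-(a i * x) - v * (a i * a i) / 2))) fun i => by fun_prop]
  simp only [h_factor]

theorem map_add_gaussianProduct_withDensity {v : ℝ≥0} (hv : v ≠ 0) (a : ι → ℝ) :
    ((gaussianProduct ι v).withDensity fun z => ENNReal.ofReal (shiftDensity v a z)).map
      (· + (v : ℝ) • a) = gaussianProduct ι v := by
  rw [gaussianProduct_withDensity_shiftDensity hv]
  refine (Measure.pi_map_pi (f := fun i x => x + (v : ℝ) * a i) fun i => by fun_prop).trans ?_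
  simp only [gaussianReal_map_add_const, neg_add_cancel]

theorem lintegral_comp_add_mul_shiftDensity {v : ℝ≥0} (hv : v ≠ 0) (a : ι → ℝ)
    {f : (ι → ℝ) → ℝ≥0∞} (hf : Measurable f) :
    ∫⁻ z, f (z + (v : ℝ) • a) * ENNReal.ofReal (shiftDensity v a z) ∂gaussianProduct ι v =
      ∫⁻ z, f z ∂gaussianProduct ι v := by
  conv_rhs => rw [← map_add_gaussianProduct_withDensity hv a]
  rw [lintegral_map hf (by fun_prop),
    lintegral_withDensity_eq_lintegral_mul _ (by fun_prop) (by fun_prop)]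
  exact lintegral_congr fun z => mul_comm _ _

theorem integral_comp_add_mul_shiftDensity {v : ℝ≥0} (hv : v ≠ 0) (a : ι → ℝ)
    {f : (ι → ℝ) → ℝ} (hf : Measurable f) :
    ∫ z, f (z + (v : ℝ) • a) * shiftDensity v a z ∂gaussianProduct ι v =
      ∫ z, f z ∂gaussianProduct ι v := by
  conv_rhs => rw [← map_add_gaussianProduct_withDensity hv a]
  rw [integral_map (by fun_prop) hf.aestronglyMeasurable,
    integral_withDensity_eq_integral_toReal_smul (by fun_prop) (by simp)]
  refine integral_congr_ae (.of_forall fun z => ?_)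
  simp only [ENNReal.toReal_ofReal (shiftDensity_pos v a z).le, smul_eq_mul]
  exact mul_comm _ _

theorem lintegral_shiftDensity_rpow {v : ℝ≥0} (hv : v ≠ 0) (a : ι → ℝ) (k : ℝ) :
    ∫⁻ z, ENNReal.ofReal (shiftDensity v a z ^ k) ∂gaussianProduct ι v =
      ENNReal.ofReal (Real.exp (k * (k - 1) * (v * (a ⬝ᵥ a) / 2))) := by
  have h_total := lintegral_comp_add_mul_shiftDensity hv (k • a) (f := fun _ => 1) measurable_const
  simp only [one_mul, lintegral_one, measure_univ] at h_total
  simp only [shiftDensity_rpow, ENNReal.ofReal_mul (shiftDensity_pos _ _ _).le]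
  rw [lintegral_mul_const _ (by fun_prop), h_total, one_mul]

theorem eLpNorm_shiftDensity_rpow {v : ℝ≥0} (hv : v ≠ 0) (a : ι → ℝ) {s : ℝ} (hs : 0 < s)
    (k : ℝ) :
    eLpNorm (fun z => shiftDensity v a z ^ k) (ENNReal.ofReal s) (gaussianProduct ι v) =
      ENNReal.ofReal (Real.exp (k * (k * s - 1) * (v * (a ⬝ᵥ a) / 2))) := by
  refine ENNReal.rpow_left_injective hs.ne' ?_
  have h_pow z : ‖shiftDensity v a z ^ k‖ₑ ^ s = ENNReal.ofReal (shiftDensity v a z ^ (k * s)) := by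
    have h_nonneg := Real.rpow_nonneg (shiftDensity_pos v a z).le k
    rw [Real.enorm_of_nonneg h_nonneg, ENNReal.ofReal_rpow_of_nonneg h_nonneg hs.le,
      ← Real.rpow_mul (shiftDensity_pos v a z).le]
  simp only [eLpNorm_rpow_eq_lintegral hs, h_pow]
  rw [lintegral_shiftDensity_rpow hv, ENNReal.ofReal_rpow_of_nonneg (Real.exp_pos _).le hs.le,
    ← Real.exp_mul]
  ring_nf

theorem eLpNorm_comp_add_mul_shiftDensity_rpow {v : ℝ≥0} (hv : v ≠ 0) (a : ι → ℝ) {r : ℝ}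
    (hr : 0 < r) {f : (ι → ℝ) → ℝ} (hf : Measurable f) :
    eLpNorm (fun z => f (z + (v : ℝ) • a) * shiftDensity v a z ^ (1 / r)) (ENNReal.ofReal r)
      (gaussianProduct ι v) = eLpNorm f (ENNReal.ofReal r) (gaussianProduct ι v) := by
  refine ENNReal.rpow_left_injective hr.ne' ?_
  have h_pow z : ‖f (z + (v : ℝ) • a) * shiftDensity v a z ^ (1 / r)‖ₑ ^ r =
      ‖f (z + (v : ℝ) • a)‖ₑ ^ r * ENNReal.ofReal (shiftDensity v a z) := by
    have h_nonneg := Real.rpow_nonneg (shiftDensity_pos v a z).le (1 / r)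
    rw [enorm_mul, ENNReal.mul_rpow_of_nonneg _ _ hr.le, Real.enorm_of_nonneg h_nonneg,
      ENNReal.ofReal_rpow_of_nonneg h_nonneg hr.le, ← Real.rpow_mul (shiftDensity_pos v a z).le,
      one_div_mul_cancel hr.ne', Real.rpow_one]
  simp only [eLpNorm_rpow_eq_lintegral hr, h_pow]
  exact lintegral_comp_add_mul_shiftDensity hv a (f := fun z => ‖f z‖ₑ ^ r) (by fun_prop)

theorem eLpNorm_comp_add_mul_shiftDensity_le {v : ℝ≥0} (hv : v ≠ 0) (a : ι → ℝ) {p r : ℝ}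
    (hp : 0 < p) (hpr : p < r) {f : (ι → ℝ) → ℝ} (hf : Measurable f) :
    eLpNorm (fun z => f (z + (v : ℝ) • a) * shiftDensity v a z) (ENNReal.ofReal p)
        (gaussianProduct ι v) ≤
      eLpNorm f (ENNReal.ofReal r) (gaussianProduct ι v) *
        ENNReal.ofReal (Real.exp ((p - 1) * (r - 1) / (r - p) * (v * (a ⬝ᵥ a) / 2))) := by
  have hr : 0 < r := hp.trans hpr
  have hrp : 0 < r - p := sub_pos.2 hpr
  set s : ℝ := p * r / (r - p) with hs_def
  have hs : 0 < s := by positivity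
  have h_triple : Real.HolderTriple r s p := ⟨by rw [hs_def]; field_simp; ring, hr, hs⟩
  have := h_triple.ennrealOfReal
  -- the factor `D^{1/r}` of the density `D` restores the `L^r` norm of `f` exactly
  have h_split : (fun z => f (z + (v : ℝ) • a) * shiftDensity v a z) =
      (fun z => f (z + (v : ℝ) • a) * shiftDensity v a z ^ (1 / r)) •
        fun z => shiftDensity v a z ^ (1 - 1 / r) := by
    ext z
    rw [Pi.smul_apply', smul_eq_mul, mul_assoc, ← Real.rpow_add (shiftDensity_pos v a z),
      add_sub_cancel, Real.rpow_one]
  have h_exponent : (1 - 1 / r) * ((1 - 1 / r) * s - 1) = (p - 1) * (r - 1) / (r - p) := by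
    rw [hs_def]
    field_simp
    ring
  rw [h_split, ← eLpNorm_comp_add_mul_shiftDensity_rpow hv a hr hf, ← h_exponent,
    ← eLpNorm_shiftDensity_rpow hv a hs]
  exact eLpNorm_smul_le_mul_eLpNorm
    ((measurable_shiftDensity v a).pow_const _).aestronglyMeasurable (by fun_prop)

end GaussianProduct

/-! ### Brownian increments over a grid -/

section Grid

variable {q : ℕ} (T : ℝ≥0) (n : ℕ)

/-- The point `i T / n` of the uniform grid with `n` steps on `[0, T]`. -/
noncomputable def gridPoint (i : ℕ) : ℝ≥0 := i * T / n

/-- The increments of the coordinates of the path `w` over the grid with `n` steps on `[0, T]`. -/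
noncomputable def gridIncrements (w : ℝ≥0 → Vec q) : Fin q × Fin n → ℝ :=
  fun a => w (gridPoint T n (a.2 + 1)) a.1 - w (gridPoint T n a.2) a.1

/-- The path that starts at `0`, is constant between the points of the grid with `n` steps on
`[0, T]`, and has the increments `z` there. -/
noncomputable def stepPath (z : Fin q × Fin n → ℝ) (t : ℝ≥0) : Vec q :=
  WithLp.toLp 2 fun j => ∑ i : Fin n, if gridPoint T n (i + 1) ≤ t then z (j, i) else 0

/-- The path `w` with drift `θ`. -/
noncomputable def driftedPath (θ : Vec q) (w : ℝ≥0 → Vec q) (t : ℝ≥0) : Vec q :=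
  w t + (t : ℝ) • θ

theorem gridPoint_zero : gridPoint T n 0 = 0 := by simp [gridPoint]

theorem gridPoint_mono : Monotone (gridPoint T n) := fun i j hij => by
  unfold gridPoint
  gcongr

theorem gridPoint_succ_sub (i : ℕ) :
    (gridPoint T n (i + 1) : ℝ) - gridPoint T n i = (T : ℝ) / n := by
  simp only [gridPoint]
  push_cast
  ring

theorem gridPoint_mul_right {m : ℕ} (hm : m ≠ 0) (i : ℕ) :
    gridPoint T (n * m) (i * m) = gridPoint T n i := by
  have hm' : (m : ℝ≥0) ≠ 0 := Nat.cast_ne_zero.2 hm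
  unfold gridPoint
  push_cast
  rw [mul_right_comm, mul_div_mul_right _ _ hm']

@[fun_prop]
theorem measurable_gridIncrements :
    Measurable (gridIncrements T n : (ℝ≥0 → Vec q) → Fin q × Fin n → ℝ) := by
  unfold gridIncrements
  fun_prop

@[fun_prop]
theorem measurable_stepPath :
    Measurable (stepPath T n : (Fin q × Fin n → ℝ) → ℝ≥0 → Vec q) := by
  refine measurable_pi_lambda _ fun t => (WithLp.measurable_toLp 2 _).comp ?_
  refine measurable_pi_lambda _ fun j => Finset.measurable_fun_sum _ fun i _ => ?_
  split_ifs <;> fun_prop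

theorem gridIncrements_driftedPath (θ : Vec q) (w : ℝ≥0 → Vec q) :
    gridIncrements T n (driftedPath θ w) =
      gridIncrements T n w + ((T : ℝ) / n) • fun a => θ a.1 := by
  ext a
  simp only [gridIncrements, driftedPath, PiLp.add_apply, PiLp.smul_apply, Pi.add_apply,
    Pi.smul_apply, smul_eq_mul, ← gridPoint_succ_sub T n a.2]
  ring

variable {T n}

theorem gridPoint_self (hn : n ≠ 0) : gridPoint T n n = T :=
  mul_div_cancel_left₀ T (Nat.cast_ne_zero.2 hn)

theorem gridPoint_le_gridPoint_iff (hT : T ≠ 0) (hn : n ≠ 0) {i j : ℕ} :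
    gridPoint T n i ≤ gridPoint T n j ↔ i ≤ j := by
  have hn' : (0 : ℝ≥0) < n := by positivity
  unfold gridPoint
  rw [div_le_div_iff_of_pos_right hn', mul_le_mul_iff_left₀ (pos_iff_ne_zero.2 hT), Nat.cast_le]

theorem gridIncrements_stepPath (hT : T ≠ 0) (z : Fin q × Fin n → ℝ) :
    gridIncrements T n (stepPath T n z) = z := by
  ext ⟨j, i⟩
  have hn : n ≠ 0 := i.pos.ne'
  simp only [gridIncrements, stepPath, gridPoint_le_gridPoint_iff hT hn, ← Finset.sum_sub_distrib]
  rw [Finset.sum_eq_single_of_mem i (Finset.mem_univ i) fun k _ hk => ?_]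
  · simp
  · have : (k : ℕ) ≠ i := Fin.val_ne_of_ne hk
    split_ifs <;> first | omega | simp

theorem sub_eval_zero_eq_of_gridIncrements_eq {w w' : ℝ≥0 → Vec q}
    (h : gridIncrements T n w = gridIncrements T n w') {i : ℕ} (hi : i ≤ n) :
    w (gridPoint T n i) - w 0 = w' (gridPoint T n i) - w' 0 := by
  induction i with
  | zero => simp [gridPoint_zero]
  | succ i ih =>
    have h_step : w (gridPoint T n (i + 1)) - w (gridPoint T n i) =
        w' (gridPoint T n (i + 1)) - w' (gridPoint T n i) := by
      ext j
      exact congrFun h (j, ⟨i, hi⟩)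
    rw [← sub_add_sub_cancel, h_step, ih (Nat.le_of_succ_le hi), sub_add_sub_cancel]

theorem sum_gridIncrements (hn : n ≠ 0) (w : ℝ≥0 → Vec q) (j : Fin q) :
    ∑ i, gridIncrements T n w (j, i) = w T j - w 0 j := by
  simp only [gridIncrements]
  rw [Fin.sum_univ_eq_sum_range fun i => w (gridPoint T n (i + 1)) j - w (gridPoint T n i) j,
    Finset.sum_range_sub fun i => w (gridPoint T n i) j, gridPoint_self hn, gridPoint_zero]

theorem mul_dotProduct_fst_eq (hn : n ≠ 0) (θ : Vec q) :
    ((T / n : ℝ≥0) : ℝ) * ((fun a : Fin q × Fin n => θ a.1) ⬝ᵥ fun a => θ a.1) = T * ‖θ‖ ^ 2 := by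
  have hn' : (n : ℝ) ≠ 0 := Nat.cast_ne_zero.2 hn
  simp only [dotProduct, Fintype.sum_prod_type, Finset.sum_const, Finset.card_univ,
    Fintype.card_fin, nsmul_eq_mul, EuclideanSpace.real_norm_sq_eq, ← Finset.mul_sum, ← sq,
    NNReal.coe_div, NNReal.coe_natCast]
  field_simp

theorem girsanovMinus_eq_shiftDensity (hn : n ≠ 0) (θ : Vec q) {w : ℝ≥0 → Vec q} (hw : w 0 = 0) :
    girsanovMinus T (w T) θ = shiftDensity (T / n) (fun a => θ a.1) (gridIncrements T n w) := by
  have h_inner : inner ℝ θ (w T) = (fun a => θ a.1) ⬝ᵥ gridIncrements T n w := by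
    simp only [dotProduct, Fintype.sum_prod_type, ← Finset.mul_sum, sum_gridIncrements hn, hw,
      PiLp.zero_apply, sub_zero, PiLp.inner_apply]
    exact Finset.sum_congr rfl fun j _ => mul_comm _ _
  rw [girsanovMinus, shiftDensity, mul_dotProduct_fst_eq hn, h_inner, mul_comm (‖θ‖ ^ 2)]

theorem apply_stepPath_gridIncrements (hT : T ≠ 0) {S : Type*} {H : (ℝ≥0 → Vec q) → S}
    (hH : Function.FactorsThrough H (gridIncrements T n)) (w : ℝ≥0 → Vec q) :
    H (stepPath T n (gridIncrements T n w)) = H w :=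
  hH (gridIncrements_stepPath hT _)

end Grid

section BrownianMotion

variable {Ω Ω' : Type*} [MeasurableSpace Ω] [MeasurableSpace Ω'] {μ : Measure Ω} {μ' : Measure Ω'}
  {q n : ℕ} {T : ℝ≥0} {W : ℝ≥0 → Ω → Vec q} {W' : ℝ≥0 → Ω' → Vec q}

namespace IsBrownianMotion

theorem measurable_path (hW : IsBrownianMotion W μ) : Measurable fun ω t => W t ω :=
  measurable_pi_lambda _ hW.measurable

theorem eval_zero_ae_eq_zero (hW : IsBrownianMotion W μ) : ∀ᵐ ω ∂μ, W 0 ω = 0 := by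
  filter_upwards [ae_all_iff.2 fun j => (hW.coord j).toIsPreBrownianReal.eval_zero_ae_eq_zero]
    with ω hω
  ext j
  exact hω j

theorem iIndepFun_gridIncrements (hW : IsBrownianMotion W μ) (T : ℝ≥0) (n : ℕ) :
    iIndepFun (fun (a : Fin q × Fin n) ω => gridIncrements T n (fun t => W t ω) a) μ := by
  have hW_meas := hW.measurable
  have := hW.indep.isProbabilityMeasure
  refine iIndepFun_uncurry' (X := fun (j : Fin q) (i : Fin n) ω =>
    W (gridPoint T n (i + 1)) ω j - W (gridPoint T n i) ω j) (fun j i => by fun_prop) ?_ fun j => ?_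
  · exact hW.indep.comp (fun _ y (i : Fin n) => y (gridPoint T n (i + 1)) - y (gridPoint T n i))
      fun _ => by fun_prop
  · exact ((hW.coord j).toIsPreBrownianReal.hasIndepIncrements.nat (gridPoint_mono T n)).precomp
      Fin.val_injective

theorem measurePreserving_gridIncrements (hW : IsBrownianMotion W μ) (T : ℝ≥0) (n : ℕ) :
    MeasurePreserving (fun ω => gridIncrements T n fun t => W t ω) μ
      (gaussianProduct (Fin q × Fin n) (T / n)) := by
  have h_meas : Measurable fun ω => gridIncrements T n fun t => W t ω :=
    (measurable_gridIncrements T n).comp hW.measurable_path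
  refine ⟨h_meas, ?_⟩
  have := hW.indep.isProbabilityMeasure
  refine ((iIndepFun_iff_map_fun_eq_pi_map fun a => h_meas.eval.aemeasurable).1
    (hW.iIndepFun_gridIncrements T n)).trans ?_
  congr 1
  ext1 a
  have h_law := ((hW.coord a.1).toIsPreBrownianReal.hasLaw_sub (gridPoint T n (a.2 + 1))
    (gridPoint T n a.2)).map_eq
  have h_var : nndist (gridPoint T n (a.2 + 1) : ℝ) (gridPoint T n a.2) = T / n := by
    ext
    rw [coe_nndist, Real.dist_eq, gridPoint_succ_sub, abs_of_nonneg (by positivity)]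
    push_cast
    rfl
  exact h_law.trans (congrArg _ h_var)

theorem identDistrib_of_factorsThrough (hW : IsBrownianMotion W μ) (hW' : IsBrownianMotion W' μ')
    (hT : T ≠ 0) {H : (ℝ≥0 → Vec q) → ℝ} (hH_meas : Measurable H)
    (hH : Function.FactorsThrough H (gridIncrements T n)) :
    IdentDistrib (fun ω => H fun t => W t ω) (fun ω => H fun t => W' t ω) μ μ' := by
  have h_grid := hW.measurePreserving_gridIncrements T n
  have h_grid' := hW'.measurePreserving_gridIncrements T n
  have h_incr : IdentDistrib (fun ω => gridIncrements T n fun t => W t ω)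
      (fun ω => gridIncrements T n fun t => W' t ω) μ μ' :=
    ⟨h_grid.aemeasurable, h_grid'.aemeasurable, h_grid.map_eq.trans h_grid'.map_eq.symm⟩
  have h_step := h_incr.comp (hH_meas.comp (measurable_stepPath T n))
  simpa only [Function.comp_def, apply_stepPath_gridIncrements hT hH] using h_step

theorem comp_driftedPath_mul_girsanovMinus_ae_eq (hW : IsBrownianMotion W μ) (hT : T ≠ 0)
    (hn : n ≠ 0) {H : (ℝ≥0 → Vec q) → ℝ} (hH : Function.FactorsThrough H (gridIncrements T n))
    (θ : Vec q) :
    (fun ω => H (driftedPath θ fun t => W t ω) * girsanovMinus T (W T ω) θ) =ᵐ[μ]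
      (fun z => H (stepPath T n (z + ((T / n : ℝ≥0) : ℝ) • fun a => θ a.1)) *
        shiftDensity (T / n) (fun a => θ a.1) z) ∘ fun ω => gridIncrements T n fun t => W t ω := by
  filter_upwards [hW.eval_zero_ae_eq_zero] with ω hω
  simp only [Function.comp_apply, NNReal.coe_div, NNReal.coe_natCast,
    ← gridIncrements_driftedPath, apply_stepPath_gridIncrements hT hH]
  rw [girsanovMinus_eq_shiftDensity (w := fun t => W t ω) hn θ hω]

theorem integral_comp_driftedPath_mul_girsanovMinus (hW : IsBrownianMotion W μ) (hT : T ≠ 0)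
    (hn : n ≠ 0) {H : (ℝ≥0 → Vec q) → ℝ} (hH_meas : Measurable H)
    (hH : Function.FactorsThrough H (gridIncrements T n)) (θ : Vec q) :
    ∫ ω, H (driftedPath θ fun t => W t ω) * girsanovMinus T (W T ω) θ ∂μ =
      ∫ ω, H (fun t => W t ω) ∂μ := by
  have h_law := (hW.measurePreserving_gridIncrements T n).hasLaw
  have hH_step : Measurable fun z => H (stepPath T n z) := hH_meas.comp (measurable_stepPath T n)
  have hv : T / n ≠ 0 := by positivity
  rw [integral_congr_ae (hW.comp_driftedPath_mul_girsanovMinus_ae_eq hT hn hH θ),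
    h_law.integral_comp (by fun_prop), integral_comp_add_mul_shiftDensity hv _ hH_step,
    ← h_law.integral_comp hH_step.aestronglyMeasurable]
  simp only [Function.comp_apply, apply_stepPath_gridIncrements hT hH]

theorem eLpNorm_comp_driftedPath_mul_girsanovMinus_le (hW : IsBrownianMotion W μ) (hT : T ≠ 0)
    (hn : n ≠ 0) {H : (ℝ≥0 → Vec q) → ℝ} (hH_meas : Measurable H)
    (hH : Function.FactorsThrough H (gridIncrements T n)) (θ : Vec q) {p r : ℝ} (hp : 0 < p)
    (hpr : p < r) :
    eLpNorm (fun ω => H (driftedPath θ fun t => W t ω) * girsanovMinus T (W T ω) θ)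
        (ENNReal.ofReal p) μ ≤
      eLpNorm (fun ω => H fun t => W t ω) (ENNReal.ofReal r) μ *
        ENNReal.ofReal (Real.exp ((p - 1) * (r - 1) / (r - p) * (T * ‖θ‖ ^ 2 / 2))) := by
  have h_grid := hW.measurePreserving_gridIncrements T n
  have hH_step : Measurable fun z => H (stepPath T n z) := hH_meas.comp (measurable_stepPath T n)
  have hv : T / n ≠ 0 := by positivity
  rw [eLpNorm_congr_ae (hW.comp_driftedPath_mul_girsanovMinus_ae_eq hT hn hH θ),
    eLpNorm_comp_measurePreserving (by fun_prop) h_grid, ← mul_dotProduct_fst_eq hn]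
  refine (eLpNorm_comp_add_mul_shiftDensity_le hv _ hp hpr hH_step).trans_eq ?_
  rw [← eLpNorm_comp_measurePreserving hH_step.aestronglyMeasurable h_grid]
  simp only [Function.comp_def, apply_stepPath_gridIncrements hT hH]

end IsBrownianMotion

end BrownianMotion

/-! ### Moments of the level terms -/

section Scheme

variable {d q : ℕ} {Φ : ℝ → Vec d → Vec q → Vec d} {x : Vec d} {T : ℝ≥0} {P : Vec d → ℝ}

theorem schemePath_succ (n : ℕ) (θ : Vec q) (w : ℝ≥0 → Vec q) (i : ℕ) :
    schemePath Φ x T n θ w (i + 1) = Φ ((T : ℝ) / n) (schemePath Φ x T n θ w i)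
      (w (gridPoint T n (i + 1)) - w (gridPoint T n i) + ((T : ℝ) / n) • θ) := by
  simp only [schemePath, gridPoint, Nat.cast_add, Nat.cast_one]

theorem schemePath_driftedPath (n : ℕ) (θ : Vec q) (w : ℝ≥0 → Vec q) (i : ℕ) :
    schemePath Φ x T n 0 (driftedPath θ w) i = schemePath Φ x T n θ w i := by
  induction i with
  | zero => rfl
  | succ i ih =>
    rw [schemePath_succ, schemePath_succ, ih, ← gridPoint_succ_sub T n i]
    congr 1
    simp only [driftedPath, smul_zero, add_zero, sub_smul]
    abel

theorem measurable_schemePath (hΦ : ∀ h, Measurable fun z : Vec d × Vec q => Φ h z.1 z.2)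
    (n i : ℕ) :
    Measurable fun z : Vec q × (ℝ≥0 → Vec q) => schemePath Φ x T n z.1 z.2 i := by
  induction i with
  | zero => exact measurable_const
  | succ i ih =>
    simp only [schemePath_succ]
    exact (hΦ _).comp (ih.prodMk (by fun_prop))

theorem schemePath_eq_of_gridIncrements_eq {n k : ℕ} (hk : k ≠ 0) (θ : Vec q)
    {w w' : ℝ≥0 → Vec q} (h : gridIncrements T (n * k) w = gridIncrements T (n * k) w') {i : ℕ}
    (hi : i ≤ n) : schemePath Φ x T n θ w i = schemePath Φ x T n θ w' i := by
  have h_eval {j : ℕ} (hj : j ≤ n) :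
      w (gridPoint T n j) - w 0 = w' (gridPoint T n j) - w' 0 := by
    rw [← gridPoint_mul_right T n hk]
    exact sub_eval_zero_eq_of_gridIncrements_eq h (Nat.mul_le_mul_right k hj)
  induction i with
  | zero => rfl
  | succ i ih =>
    rw [schemePath_succ, schemePath_succ, ih (Nat.le_of_succ_le hi),
      ← sub_sub_sub_cancel_right _ _ (w 0), h_eval hi, h_eval (Nat.le_of_succ_le hi),
      sub_sub_sub_cancel_right]

variable (Φ x T P) in
/-- The difference of the payoffs of the schemes with `n` and with `m` steps, both without drift
and driven by the path `w`. -/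
noncomputable def payoffDiff (n m : ℕ) (w : ℝ≥0 → Vec q) : ℝ :=
  P (schemeEnd Φ x T n 0 w) - P (schemeEnd Φ x T m 0 w)

theorem measurable_payoffDiff (hΦ : ∀ h, Measurable fun z : Vec d × Vec q => Φ h z.1 z.2)
    (hP : Measurable P) (n m : ℕ) : Measurable (payoffDiff Φ x T P n m) := by
  have h_end (n : ℕ) : Measurable fun w => schemeEnd Φ x T n 0 w :=
    (measurable_schemePath hΦ n n).comp (measurable_const.prodMk measurable_id)
  exact (hP.comp (h_end n)).sub (hP.comp (h_end m))

theorem payoffDiff_factorsThrough_gridIncrements (n : ℕ) {k : ℕ} (hk : k ≠ 0) :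
    Function.FactorsThrough (payoffDiff Φ x T P (n * k) n) (gridIncrements T (n * k)) := by
  intro w w' h
  have h_fine : schemeEnd Φ x T (n * k) 0 w = schemeEnd Φ x T (n * k) 0 w' :=
    schemePath_eq_of_gridIncrements_eq one_ne_zero 0 (by rwa [mul_one]) le_rfl
  have h_coarse : schemeEnd Φ x T n 0 w = schemeEnd Φ x T n 0 w' :=
    schemePath_eq_of_gridIncrements_eq hk 0 h le_rfl
  rw [payoffDiff, payoffDiff, h_fine, h_coarse]

theorem levelTerm_eq_payoffDiff_driftedPath (n₀ M : ℕ) (m : ℝ) (l : ℕ) (θ : Vec q)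
    (w : ℝ≥0 → Vec q) :
    levelTerm Φ x T n₀ M P m l θ w =
      payoffDiff Φ x T P (n₀ * M ^ (l - 1)) (n₀ * M ^ (l - 2)) (driftedPath θ w) *
        girsanovMinus T (w T) θ - m := by
  simp only [levelTerm, payoffDiff, schemeEnd, schemePath_driftedPath]

theorem measurable_levelTerm (hΦ : ∀ h, Measurable fun z : Vec d × Vec q => Φ h z.1 z.2)
    (hP : Measurable P) (n₀ M : ℕ) (m : ℝ) (l : ℕ) :
    Measurable fun z : Vec q × (ℝ≥0 → Vec q) => levelTerm Φ x T n₀ M P m l z.1 z.2 := by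
  have h_end (n : ℕ) : Measurable fun z : Vec q × (ℝ≥0 → Vec q) =>
      P (schemeEnd Φ x T n z.1 z.2) := hP.comp (measurable_schemePath hΦ n n)
  have h_girsanov : Measurable fun z : Vec q × (ℝ≥0 → Vec q) =>
      girsanovMinus T (z.2 T) z.1 := by
    unfold girsanovMinus
    fun_prop
  exact (((h_end _).sub (h_end _)).mul h_girsanov).sub_const _

end Scheme

section LevelMoments

theorem eLpNorm_sub_integral_le {Ω : Type*} [MeasurableSpace Ω] {μ : Measure Ω}
    [IsProbabilityMeasure μ] {f : Ω → ℝ} (hf : AEStronglyMeasurable f μ) {p : ℝ≥0∞} (hp : 1 ≤ p) :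
    eLpNorm (fun ω => f ω - ∫ ω', f ω' ∂μ) p μ ≤ 2 * eLpNorm f p μ := by
  have h_mean : ‖∫ ω, f ω ∂μ‖ₑ ≤ eLpNorm f p μ := by
    refine (enorm_integral_le_lintegral_enorm f).trans ?_
    rw [← eLpNorm_one_eq_lintegral_enorm]
    exact eLpNorm_le_eLpNorm_of_exponent_le hp hf
  refine (eLpNorm_sub_le hf aestronglyMeasurable_const hp).trans ?_
  rw [two_mul, eLpNorm_const _ (by positivity) (IsProbabilityMeasure.ne_zero μ), measure_univ,
    ENNReal.one_rpow, mul_one]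
  gcongr

variable {Ω₀ : Type*} [MeasurableSpace Ω₀] {μ₀ : Measure Ω₀} {d q : ℕ}
  {Φ : ℝ → Vec d → Vec q → Vec d} {x : Vec d} {T : ℝ≥0} {n₀ : ℕ} {P : Vec d → ℝ}
  {W₀ : ℝ≥0 → Ω₀ → Vec q} {X : ℝ≥0 → Ω₀ → Vec d} {r β V : ℝ}

theorem StrongError.eLpNorm_le (hS : StrongError μ₀ Φ x T n₀ P W₀ X r β V) (hr : 0 < r)
    (hV : 0 ≤ V) {n : ℕ} (hn : 1 ≤ n) :
    eLpNorm (fun ω => P (schemeEnd Φ x T (n₀ * n) 0 fun t => W₀ t ω) - P (X T ω))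
        (ENNReal.ofReal r) μ₀ ≤
      ENNReal.ofReal (V ^ (1 / r) * ((T : ℝ) / n₀ / n) ^ (β / 2)) := by
  rw [← ENNReal.rpow_le_rpow_iff hr, eLpNorm_rpow_eq_lintegral hr,
    ENNReal.ofReal_rpow_of_nonneg (by positivity) hr.le,
    Real.mul_rpow (by positivity) (by positivity), ← Real.rpow_mul hV,
    ← Real.rpow_mul (by positivity), one_div_mul_cancel hr.ne', Real.rpow_one,
    show β / 2 * r = β * r / 2 by ring]
  refine Eq.trans_le (lintegral_congr fun ω => ?_) (hS n hn)
  rw [Real.enorm_eq_ofReal_abs, ENNReal.ofReal_rpow_of_nonneg (abs_nonneg _) hr.le]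

theorem eLpNorm_payoffDiff_le (hW₀ : IsBrownianMotion W₀ μ₀)
    (hΦ : ∀ h, Measurable fun z : Vec d × Vec q => Φ h z.1 z.2) (hP : Measurable P)
    (hX : Measurable (X T)) (hr : 1 ≤ r) (hβ : 0 ≤ β) (hV : 0 ≤ V)
    (hS : StrongError μ₀ Φ x T n₀ P W₀ X r β V) {n k : ℕ} (hn : 1 ≤ n) (hk : 1 ≤ k) :
    eLpNorm (fun ω => payoffDiff Φ x T P (n₀ * n * k) (n₀ * n) fun t => W₀ t ω)
        (ENNReal.ofReal r) μ₀ ≤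
      ENNReal.ofReal (2 * V ^ (1 / r) * ((T : ℝ) / n₀ / n) ^ (β / 2)) := by
  have hr0 : 0 < r := by positivity
  have h_meas (m : ℕ) : AEStronglyMeasurable
      (fun ω => P (schemeEnd Φ x T m 0 fun t => W₀ t ω) - P (X T ω)) μ₀ := by
    have h_end : Measurable fun ω => schemeEnd Φ x T m 0 fun t => W₀ t ω :=
      (measurable_schemePath hΦ m m).comp (measurable_const.prodMk hW₀.measurable_path)
    exact ((hP.comp h_end).sub (hP.comp hX)).aestronglyMeasurable
  have h_fine : eLpNorm (fun ω => P (schemeEnd Φ x T (n₀ * (n * k)) 0 fun t => W₀ t ω) - P (X T ω))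
      (ENNReal.ofReal r) μ₀ ≤ ENNReal.ofReal (V ^ (1 / r) * ((T : ℝ) / n₀ / n) ^ (β / 2)) := by
    refine (hS.eLpNorm_le hr0 hV (Nat.mul_pos hn hk)).trans (ENNReal.ofReal_le_ofReal ?_)
    have h_step : (T : ℝ) / n₀ / (n * k : ℕ) ≤ (T : ℝ) / n₀ / n := by
      gcongr
      exact Nat.le_mul_of_pos_right n hk
    gcongr
  have h_split : (fun ω => payoffDiff Φ x T P (n₀ * n * k) (n₀ * n) fun t => W₀ t ω) =
      (fun ω => P (schemeEnd Φ x T (n₀ * (n * k)) 0 fun t => W₀ t ω) - P (X T ω)) -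
        fun ω => P (schemeEnd Φ x T (n₀ * n) 0 fun t => W₀ t ω) - P (X T ω) := by
    ext ω
    simp only [payoffDiff, mul_assoc, Pi.sub_apply, sub_sub_sub_cancel_right]
  rw [h_split, mul_assoc, two_mul, ENNReal.ofReal_add (by positivity) (by positivity)]
  exact (eLpNorm_sub_le (h_meas _) (h_meas _) (by simpa using hr)).trans
    (add_le_add h_fine (hS.eLpNorm_le hr0 hV hn))

/-- The factor in front of `h ^ (β / 2)` in the bound for the `L^p` norm of the level terms, where
`h` is the coarser of the two steps: `2 V ^ (1 / r)` comes from the strong error, the exponential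
from the change of drift, and a factor `2` from the centring. -/
noncomputable def levelConst (T p c r V : ℝ) : ℝ :=
  2 * (2 * V ^ (1 / r) * Real.exp ((p - 1) * (r - 1) / (r - p) * (T * c ^ 2 / 2)))

variable {Ω : Type*} [MeasurableSpace Ω] {μ : Measure Ω} {W : ℝ≥0 → Ω → Vec q}

theorem IsBrownianMotion.integral_payoffDiff_driftedPath_mul_girsanovMinus
    (hW₀ : IsBrownianMotion W₀ μ₀) (hW : IsBrownianMotion W μ)
    (hΦ : ∀ h, Measurable fun z : Vec d × Vec q => Φ h z.1 z.2) (hP : Measurable P) (hT : T ≠ 0)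
    {n k : ℕ} (hn : n ≠ 0) (hk : k ≠ 0) (θ : Vec q) :
    ∫ ω, payoffDiff Φ x T P (n * k) n (driftedPath θ fun t => W t ω) *
        girsanovMinus T (W T ω) θ ∂μ =
      ∫ ω, payoffDiff Φ x T P (n * k) n fun t => W₀ t ω ∂μ₀ := by
  have h_meas := measurable_payoffDiff (x := x) (T := T) hΦ hP (n * k) n
  have h_fact := payoffDiff_factorsThrough_gridIncrements (Φ := Φ) (x := x) (T := T) (P := P) n hk
  rw [hW.integral_comp_driftedPath_mul_girsanovMinus hT (mul_ne_zero hn hk) h_meas h_fact θ]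
  exact (hW.identDistrib_of_factorsThrough hW₀ hT h_meas h_fact).integral_eq

theorem IsBrownianMotion.eLpNorm_payoffDiff_driftedPath_mul_girsanovMinus_le
    (hW₀ : IsBrownianMotion W₀ μ₀) (hW : IsBrownianMotion W μ)
    (hΦ : ∀ h, Measurable fun z : Vec d × Vec q => Φ h z.1 z.2) (hP : Measurable P) (hT : T ≠ 0)
    (hX : Measurable (X T)) {p c : ℝ} (hp : 1 ≤ p) (hpr : p < r) (hβ : 0 ≤ β) (hV : 0 ≤ V)
    (hS : StrongError μ₀ Φ x T n₀ P W₀ X r β V) (hn₀ : 1 ≤ n₀) {n k : ℕ} (hn : 1 ≤ n) (hk : 1 ≤ k)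
    {θ : Vec q} (hθ : ‖θ‖ ≤ c) :
    eLpNorm (fun ω => payoffDiff Φ x T P (n₀ * n * k) (n₀ * n) (driftedPath θ fun t => W t ω) *
        girsanovMinus T (W T ω) θ) (ENNReal.ofReal p) μ ≤
      ENNReal.ofReal (levelConst T p c r V / 2 * ((T : ℝ) / n₀ / n) ^ (β / 2)) := by
  have hk' : k ≠ 0 := by positivity
  have h_meas := measurable_payoffDiff (x := x) (T := T) hΦ hP (n₀ * n * k) (n₀ * n)
  have h_fact := payoffDiff_factorsThrough_gridIncrements (Φ := Φ) (x := x) (T := T) (P := P)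
    (n₀ * n) hk'
  have h_exponent : 0 ≤ (p - 1) * (r - 1) / (r - p) :=
    div_nonneg (mul_nonneg (by linarith) (by linarith)) (by linarith)
  refine (hW.eLpNorm_comp_driftedPath_mul_girsanovMinus_le hT (by positivity) h_meas h_fact θ
    (by positivity) hpr).trans ?_
  rw [(hW.identDistrib_of_factorsThrough hW₀ hT h_meas h_fact).eLpNorm_eq]
  refine (mul_le_mul_left (eLpNorm_payoffDiff_le hW₀ hΦ hP hX (hp.trans hpr.le) hβ hV hS hn hk)
    _).trans ?_
  rw [← ENNReal.ofReal_mul (by positivity)]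
  refine ENNReal.ofReal_le_ofReal ?_
  rw [levelConst, mul_div_cancel_left₀ _ two_ne_zero, mul_right_comm]
  gcongr

theorem pow_pred_eq_pow_sub_two_mul {M l : ℕ} (hl : 2 ≤ l) : M ^ (l - 1) = M ^ (l - 2) * M := by
  rw [← pow_succ]
  congr 1
  omega

theorem IsBrownianMotion.levelMean_eq (hW₀ : IsBrownianMotion W₀ μ₀) (hW : IsBrownianMotion W μ)
    (hΦ : ∀ h, Measurable fun z : Vec d × Vec q => Φ h z.1 z.2) (hP : Measurable P) (hT : T ≠ 0)
    (hn₀ : n₀ ≠ 0) {M l : ℕ} (hM : M ≠ 0) (hl : 2 ≤ l) (θ : Vec q) :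
    levelMean μ₀ Φ x T n₀ M P W₀ l =
      ∫ ω, levelTerm Φ x T n₀ M P 0 l θ (fun t => W t ω) ∂μ := by
  simp only [levelTerm_eq_payoffDiff_driftedPath, sub_zero, pow_pred_eq_pow_sub_two_mul hl,
    ← mul_assoc]
  rw [integral_payoffDiff_driftedPath_mul_girsanovMinus hW₀ hW hΦ hP hT
    (mul_ne_zero hn₀ (pow_ne_zero _ hM)) hM]
  simp only [levelMean, payoffDiff, pow_pred_eq_pow_sub_two_mul hl, ← mul_assoc]

theorem IsBrownianMotion.integral_levelTerm_eq_zero [IsProbabilityMeasure μ]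
    (hW₀ : IsBrownianMotion W₀ μ₀) (hW : IsBrownianMotion W μ)
    (hΦ : ∀ h, Measurable fun z : Vec d × Vec q => Φ h z.1 z.2) (hP : Measurable P) (hT : T ≠ 0)
    (hn₀ : n₀ ≠ 0) {M l : ℕ} (hM : M ≠ 0) (hl : 2 ≤ l) (θ : Vec q) :
    ∫ ω, levelTerm Φ x T n₀ M P (levelMean μ₀ Φ x T n₀ M P W₀ l) l θ (fun t => W t ω) ∂μ = 0 := by
  have h_centred := integral_sub_average μ fun ω => levelTerm Φ x T n₀ M P 0 l θ fun t => W t ω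
  rw [average_eq_integral, ← levelMean_eq hW₀ hW hΦ hP hT hn₀ hM hl θ] at h_centred
  simpa only [levelTerm, sub_zero] using h_centred

theorem IsBrownianMotion.eLpNorm_levelTerm_le [IsProbabilityMeasure μ]
    (hW₀ : IsBrownianMotion W₀ μ₀) (hW : IsBrownianMotion W μ)
    (hΦ : ∀ h, Measurable fun z : Vec d × Vec q => Φ h z.1 z.2) (hP : Measurable P) (hT : T ≠ 0)
    (hX : Measurable (X T)) {p c : ℝ} (hp : 1 ≤ p) (hpr : p < r) (hβ : 0 ≤ β) (hV : 0 ≤ V)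
    (hS : StrongError μ₀ Φ x T n₀ P W₀ X r β V) (hn₀ : 1 ≤ n₀) {M l : ℕ} (hM : 1 ≤ M) (hl : 2 ≤ l)
    {θ : Vec q} (hθ : ‖θ‖ ≤ c) :
    eLpNorm (fun ω => levelTerm Φ x T n₀ M P (levelMean μ₀ Φ x T n₀ M P W₀ l) l θ fun t => W t ω)
        (ENNReal.ofReal p) μ ≤
      ENNReal.ofReal (levelConst T p c r V * ((T : ℝ) / n₀ / (M : ℝ) ^ (l - 2)) ^ (β / 2)) := by
  have h_meas : Measurable fun ω => levelTerm Φ x T n₀ M P 0 l θ fun t => W t ω :=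
    (measurable_levelTerm hΦ hP n₀ M 0 l).comp (measurable_const.prodMk hW.measurable_path)
  have h_centred := eLpNorm_sub_integral_le (μ := μ) (p := ENNReal.ofReal p)
    h_meas.aestronglyMeasurable (by simpa using hp)
  rw [← levelMean_eq hW₀ hW hΦ hP hT (by positivity) (by positivity) hl θ] at h_centred
  simp only [levelTerm_eq_payoffDiff_driftedPath, sub_zero, pow_pred_eq_pow_sub_two_mul hl,
    ← mul_assoc] at h_centred ⊢
  refine (h_centred.trans (mul_le_mul_right (eLpNorm_payoffDiff_driftedPath_mul_girsanovMinus_le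
    hW₀ hW hΦ hP hT hX hp hpr hβ hV hS hn₀ (Nat.pow_pos hM) hM hθ) 2)).trans_eq ?_
  rw [← ENNReal.ofReal_ofNat 2, ← ENNReal.ofReal_mul zero_le_two, Nat.cast_pow]
  congr 1
  ring

end LevelMoments

/-! ### Allocation of the samples -/

namespace ML2RParams

variable (π : ML2RParams)

/-- The contribution of level `l` to the sum over the levels in the sample size `N(ε)`. -/
noncomputable def sizeTerm (L l : ℕ) : ℝ :=
  |weight π.M π.α L l| * (π.M : ℝ) ^ ((1 - π.β) / 2 * ((l : ℝ) - 1))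

theorem lam_nonneg : 0 ≤ π.lam := Real.sqrt_nonneg _

theorem cLow_nonneg : 0 ≤ π.cLow := by
  unfold cLow
  positivity

theorem cUp_nonneg : 0 ≤ π.cUp := by
  unfold cUp
  positivity

theorem sizeTerm_nonneg (L l : ℕ) : 0 ≤ π.sizeTerm L l := by
  unfold sizeTerm
  positivity

theorem sum_sizeTerm_nonneg (L : ℕ) : 0 ≤ ∑ l ∈ Finset.Icc 2 L, π.sizeTerm L l :=
  Finset.sum_nonneg fun _ _ => π.sizeTerm_nonneg L _

theorem one_le_cUp_mul_cLow : 1 ≤ π.cUp * π.cLow := by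
  have h_sqrt : Real.sqrt (1 + (π.M : ℝ)⁻¹) ≠ 0 := (Real.sqrt_pos.2 (by positivity)).ne'
  rw [cUp, cLow, mul_assoc, mul_div_cancel₀ _ h_sqrt, ← sq]
  exact one_le_pow₀ (le_add_of_nonneg_right (by positivity))

variable {π}

theorem lam_sq_mul_var (hV₁ : 0 ≤ π.V₁) (hvar : 0 < π.var) : π.lam ^ 2 * π.var = π.V₁ := by
  rw [lam, Real.sq_sqrt (by positivity), div_mul_cancel₀ _ hvar.ne']

theorem preAlloc_nonneg (hh : 0 ≤ π.h) (L l : ℕ) : 0 ≤ π.preAlloc L l := by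
  have h_lam := π.lam_nonneg
  have h_cLow := π.cLow_nonneg
  unfold preAlloc
  split_ifs <;> positivity

theorem qStar_pos (hh : 0 ≤ π.h) {L : ℕ} (hL : 1 ≤ L) : 0 < π.qStar L := by
  refine inv_pos.2 (Finset.sum_pos' (fun l _ => preAlloc_nonneg hh L l)
    ⟨1, Finset.mem_Icc.2 ⟨le_rfl, hL⟩, ?_⟩)
  have h_lam := π.lam_nonneg
  rw [preAlloc, if_pos rfl]
  positivity

theorem le_size_mul_qStar (hα : 0 ≤ π.α) (hh : 0 ≤ π.h) (hvar : 0 ≤ π.var) (ε : ℝ) {L : ℕ}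
    (hL : 1 ≤ L) :
    π.var * (π.lam * π.h ^ (π.β / 2) * π.cUp * ∑ l ∈ Finset.Icc 2 L, π.sizeTerm L l) / ε ^ 2 ≤
      π.size ε L * π.qStar L := by
  have h_lam := π.lam_nonneg
  have h_cUp := π.cUp_nonneg
  have h_sum := π.sum_sizeTerm_nonneg L
  have h_size : π.size ε L * π.qStar L = (1 + 1 / (2 * π.α * L)) * (π.var *
      (1 + π.lam * π.h ^ (π.β / 2) + π.lam * π.h ^ (π.β / 2) * π.cUp *
        ∑ l ∈ Finset.Icc 2 L, π.sizeTerm L l)) / ε ^ 2 := by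
    rw [size, div_mul_eq_mul_div, mul_div_mul_right _ _ (qStar_pos hh hL).ne']
    rfl
  have h_factor : 1 ≤ 1 + 1 / (2 * π.α * L) := le_add_of_nonneg_right (by positivity)
  rw [h_size]
  refine div_le_div_of_nonneg_right
    (le_trans ?_ (le_mul_of_one_le_left (by positivity) h_factor)) (sq_nonneg _)
  gcongr
  exact le_add_of_nonneg_left (by positivity)

theorem le_levelSize (hα : 0 ≤ π.α) (hh : 0 ≤ π.h) (hV₁ : 0 ≤ π.V₁) (hvar : 0 < π.var) (ε : ℝ)
    {L l : ℕ} (hl : l ∈ Finset.Icc 2 L) :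
    π.V₁ * π.h ^ π.β * (∑ l ∈ Finset.Icc 2 L, π.sizeTerm L l) * (|weight π.M π.α L l| *
      (π.M : ℝ) ^ (-((1 + π.β) / 2) * ((l : ℝ) - 1))) / ε ^ 2 ≤ π.levelSize ε L l := by
  obtain ⟨hl_two, hlL⟩ := Finset.mem_Icc.1 hl
  have hl_ne : l ≠ 1 := by omega
  have h_size := le_size_mul_qStar hα hh hvar.le ε (show 1 ≤ L by omega)
  have h_lam := π.lam_nonneg
  have h_cLow := π.cLow_nonneg
  have h_sum := π.sum_sizeTerm_nonneg L
  have h_sq : (π.h ^ (π.β / 2)) ^ 2 = π.h ^ π.β := by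
    rw [← Real.rpow_mul_natCast hh, Nat.cast_ofNat, div_mul_cancel₀ _ two_ne_zero]
  refine le_trans ?_ (Nat.le_ceil _)
  rw [alloc, preAlloc, if_neg hl_ne]
  set S := ∑ l ∈ Finset.Icc 2 L, π.sizeTerm L l
  set H := π.h ^ (π.β / 2)
  set A := (π.M : ℝ) ^ (-((1 + π.β) / 2) * ((l : ℝ) - 1))
  set w := |weight π.M π.α L l|
  calc π.V₁ * π.h ^ π.β * S * (w * A) / ε ^ 2
      = π.lam ^ 2 * π.var * H ^ 2 * S * (w * A) / ε ^ 2 * 1 := by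
        rw [lam_sq_mul_var hV₁ hvar, h_sq, mul_one]
    _ ≤ π.lam ^ 2 * π.var * H ^ 2 * S * (w * A) / ε ^ 2 * (π.cUp * π.cLow) := by
        gcongr
        exact π.one_le_cUp_mul_cLow
    _ = π.var * (π.lam * H * π.cUp * S) / ε ^ 2 * (π.lam * H * π.cLow * w * A) := by ring
    _ ≤ π.size ε L * π.qStar L * (π.lam * H * π.cLow * w * A) := by gcongr
    _ = π.size ε L * (π.qStar L * (π.lam * H * π.cLow * w * A)) := mul_assoc _ _ _

theorem sq_weight_div_levelSize_le (hM : 1 ≤ π.M) (hα : 0 ≤ π.α) (hh : 0 < π.h) (hV₁ : 0 < π.V₁)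
    (hvar : 0 < π.var) {ε : ℝ} (hε : ε ≠ 0) {L l : ℕ} (hl : l ∈ Finset.Icc 2 L) :
    weight π.M π.α L l ^ 2 / π.levelSize ε L l *
        (π.h ^ π.β * (π.M : ℝ) ^ (-π.β * ((l : ℝ) - 1))) ≤
      ε ^ 2 / (π.V₁ * ∑ l ∈ Finset.Icc 2 L, π.sizeTerm L l) * π.sizeTerm L l := by
  rcases eq_or_ne (weight π.M π.α L l) 0 with hw | hw
  · simp [sizeTerm, hw]
  have hM0 : (0 : ℝ) < π.M := by exact_mod_cast hM
  have h_term : 0 < π.sizeTerm L l := mul_pos (abs_pos.2 hw) (Real.rpow_pos_of_pos hM0 _)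
  have h_sum : 0 < ∑ l ∈ Finset.Icc 2 L, π.sizeTerm L l :=
    Finset.sum_pos' (fun l _ => π.sizeTerm_nonneg L l) ⟨l, hl, h_term⟩
  have h_size := le_levelSize hα hh.le hV₁.le hvar ε hl
  have h_split : (π.M : ℝ) ^ (-π.β * ((l : ℝ) - 1)) =
      (π.M : ℝ) ^ ((1 - π.β) / 2 * ((l : ℝ) - 1)) *
        (π.M : ℝ) ^ (-((1 + π.β) / 2) * ((l : ℝ) - 1)) := by
    rw [← Real.rpow_add hM0]
    congr 1
    ring
  refine (mul_le_mul_of_nonneg_right (div_le_div_of_nonneg_left (sq_nonneg _) (by positivity)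
    h_size) (by positivity)).trans_eq ?_
  rw [h_split, ← sq_abs (weight π.M π.α L l)]
  set S := ∑ l ∈ Finset.Icc 2 L, π.sizeTerm L l
  rw [sizeTerm]
  field_simp

theorem sum_sq_weight_div_levelSize_le (hM : 1 ≤ π.M) (hα : 0 ≤ π.α) (hh : 0 < π.h)
    (hV₁ : 0 < π.V₁) (hvar : 0 < π.var) {ε : ℝ} (hε : ε ≠ 0) (L : ℕ) :
    ∑ l ∈ Finset.Icc 2 L, weight π.M π.α L l ^ 2 / π.levelSize ε L l *
      (π.h / (π.M : ℝ) ^ (l - 2)) ^ π.β ≤ (π.M : ℝ) ^ π.β / π.V₁ * ε ^ 2 := by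
  have hM0 : (0 : ℝ) < π.M := by exact_mod_cast hM
  have h_step {l : ℕ} (hl : l ∈ Finset.Icc 2 L) : (π.h / (π.M : ℝ) ^ (l - 2)) ^ π.β =
      (π.M : ℝ) ^ π.β * (π.h ^ π.β * (π.M : ℝ) ^ (-π.β * ((l : ℝ) - 1))) := by
    rw [← Real.rpow_natCast, Nat.cast_sub (Finset.mem_Icc.1 hl).1,
      Real.div_rpow hh.le (by positivity), ← Real.rpow_mul hM0.le, div_eq_mul_inv,
      ← Real.rpow_neg hM0.le, mul_left_comm, ← Real.rpow_add hM0]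
    congr 2
    push_cast
    ring
  calc _ = (π.M : ℝ) ^ π.β * ∑ l ∈ Finset.Icc 2 L, weight π.M π.α L l ^ 2 / π.levelSize ε L l *
        (π.h ^ π.β * (π.M : ℝ) ^ (-π.β * ((l : ℝ) - 1))) := by
        rw [Finset.mul_sum]
        refine Finset.sum_congr rfl fun l hl => ?_
        rw [h_step hl, mul_left_comm]
    _ ≤ (π.M : ℝ) ^ π.β * ∑ l ∈ Finset.Icc 2 L,
        ε ^ 2 / (π.V₁ * ∑ l ∈ Finset.Icc 2 L, π.sizeTerm L l) * π.sizeTerm L l := by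
        exact mul_le_mul_of_nonneg_left (Finset.sum_le_sum fun l hl =>
          sq_weight_div_levelSize_le hM hα hh hV₁ hvar hε hl) (by positivity)
    _ = (π.M : ℝ) ^ π.β * ((ε ^ 2 / π.V₁) * ((∑ l ∈ Finset.Icc 2 L, π.sizeTerm L l) /
        ∑ l ∈ Finset.Icc 2 L, π.sizeTerm L l)) := by
        rw [← Finset.mul_sum, div_mul_div_comm, div_mul_eq_mul_div]
    _ ≤ (π.M : ℝ) ^ π.β * ((ε ^ 2 / π.V₁) * 1) := by
        gcongr
        exact div_self_le_one _
    _ = (π.M : ℝ) ^ π.β / π.V₁ * ε ^ 2 := by ring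

end ML2RParams

/-! ### The multilevel estimator -/

section Multilevel

variable {Ω : Type*} {q : ℕ} {W : ℕ → ℕ → ℝ≥0 → Ω → Vec q}

/-- The driving paths `W^{l,k}`, indexed so that the lexicographic order runs through the samples
`k` first and through the levels `l` within a sample: the adaptive parameter `θ_l^{k-1}` then only
depends on paths with a smaller index. -/
def lexPath (W : ℕ → ℕ → ℝ≥0 → Ω → Vec q) (i : ℕ ×ₗ ℕ) (ω : Ω) (t : ℝ≥0) : Vec q :=
  W (ofLex i).2 (ofLex i).1 t ω

theorem sampleHistory_le_pastAlgebra_lexPath (T : ℝ≥0) {j k : ℕ} (hjk : j < k) (l : ℕ) :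
    sampleHistory W T j ≤ pastAlgebra (lexPath W) (toLex (k, l)) := by
  refine iSup_le fun l' => iSup₂_le fun k' hk' => iSup₂_le fun t _ => ?_
  have h_lt : toLex (k', l') < toLex (k, l) :=
    Prod.Lex.toLex_lt_toLex.2 (.inl ((Finset.mem_Icc.1 hk').2.trans_lt hjk))
  exact Measurable.comap_le ((measurable_pi_apply t).comp
    (measurable_pastAlgebra (Z := lexPath W) h_lt))

/-- The indices of the samples `k = 1, …, N l` on the levels `l ∈ s`. -/
def sampleIndices (s : Finset ℕ) (N : ℕ → ℕ) : Finset (ℕ ×ₗ ℕ) :=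
  (s.sigma fun l => Finset.Icc 1 (N l)).map
    ⟨fun y => toLex (y.2, y.1), fun _ _ h => by
      simpa [Sigma.ext_iff, and_comm] using congrArg ofLex h⟩

theorem mem_sampleIndices {s : Finset ℕ} {N : ℕ → ℕ} {i : ℕ ×ₗ ℕ} (hi : i ∈ sampleIndices s N) :
    (ofLex i).2 ∈ s ∧ (ofLex i).1 ∈ Finset.Icc 1 (N (ofLex i).2) := by
  obtain ⟨y, hy, rfl⟩ := Finset.mem_map.1 hi
  exact Finset.mem_sigma.1 hy

theorem sum_sampleIndices (s : Finset ℕ) (N : ℕ → ℕ) (f : ℕ ×ₗ ℕ → ℝ) :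
    ∑ i ∈ sampleIndices s N, f i = ∑ l ∈ s, ∑ k ∈ Finset.Icc 1 (N l), f (toLex (k, l)) := by
  rw [sampleIndices, Finset.sum_map, Finset.sum_sigma]
  rfl

variable [MeasurableSpace Ω] {μ : Measure Ω} [IsProbabilityMeasure μ]

theorem lpNorm_sum_samples_sq_le {p : ℝ} (hp : 2 ≤ p)
    (hW : ∀ l k, Measurable fun ω t => W l k t ω)
    (hind : iIndepFun (fun (i : ℕ × ℕ) (ω : Ω) (t : ℝ≥0) => W i.1 i.2 t ω) μ) (T : ℝ≥0)
    (s : Finset ℕ) (N : ℕ → ℕ) {θ : ℕ → ℕ → Ω → Vec q}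
    (hθ : ∀ l ∈ s, ∀ k, Measurable[sampleHistory W T k] (θ l k))
    {F : ℕ → Vec q × (ℝ≥0 → Vec q) → ℝ} (hF : ∀ l ∈ s, Measurable (F l))
    {b : ℕ → ℝ} (hb : ∀ l ∈ s, 0 ≤ b l)
    (hF_zero : ∀ l ∈ s, ∀ k j ω, ∫ ω', F l (θ l j ω, fun t => W l k t ω') ∂μ = 0)
    (hF_le : ∀ l ∈ s, ∀ k j ω, eLpNorm (fun ω' => F l (θ l j ω, fun t => W l k t ω'))
      (ENNReal.ofReal p) μ ≤ ENNReal.ofReal (b l)) :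
    let J : Ω → ℝ := fun ω =>
      ∑ l ∈ s, ∑ k ∈ Finset.Icc 1 (N l), F l (θ l (k - 1) ω, fun t => W l k t ω)
    MemLp J (ENNReal.ofReal p) μ ∧
      lpNorm J (ENNReal.ofReal p) μ ^ 2 ≤ 2 * expansionConst p * ∑ l ∈ s, N l * b l ^ 2 := by
  intro J
  have h_ind : iIndepFun (lexPath W) μ :=
    hind.precomp (g := fun i : ℕ ×ₗ ℕ => ((ofLex i).2, (ofLex i).1)) fun i j h =>
      ofLex.injective (Prod.ext (congrArg Prod.snd h) (congrArg Prod.fst h))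
  have h_past (i) (hi : i ∈ sampleIndices s N) :
      Measurable[pastAlgebra (lexPath W) i] (θ (ofLex i).2 ((ofLex i).1 - 1)) :=
    (hθ _ (mem_sampleIndices hi).1 _).mono (sampleHistory_le_pastAlgebra_lexPath T
      (Nat.sub_one_lt_of_lt (Finset.mem_Icc.1 (mem_sampleIndices hi).2).1) _) le_rfl
  have h_J : J = ∑ i ∈ sampleIndices s N, fun ω =>
      F (ofLex i).2 (θ (ofLex i).2 ((ofLex i).1 - 1) ω, lexPath W i ω) := by
    ext ω
    rw [Finset.sum_apply, sum_sampleIndices]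
    rfl
  have h_sum : ∑ i ∈ sampleIndices s N, b (ofLex i).2 ^ 2 = ∑ l ∈ s, N l * b l ^ 2 := by
    simp only [sum_sampleIndices, ofLex_toLex, Finset.sum_const, Nat.card_Icc, Nat.add_sub_cancel,
      nsmul_eq_mul]
  rw [h_J, ← h_sum]
  exact lpNorm_adaptive_sum_sq_le hp (fun i => hW _ _) h_ind _ h_past
    (fun i hi => hF _ (mem_sampleIndices hi).1) (fun i hi => hb _ (mem_sampleIndices hi).1)
    (fun i hi => hF_zero _ (mem_sampleIndices hi).1 _ _)
    (fun i hi => hF_le _ (mem_sampleIndices hi).1 _ _)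

theorem lpNorm_multilevel_sum_sq_le {p : ℝ} (hp : 2 ≤ p)
    (hW : ∀ l k, Measurable fun ω t => W l k t ω)
    (hind : iIndepFun (fun (i : ℕ × ℕ) (ω : Ω) (t : ℝ≥0) => W i.1 i.2 t ω) μ) (T : ℝ≥0)
    (s : Finset ℕ) (a : ℕ → ℝ) (N : ℕ → ℕ) {θ : ℕ → ℕ → Ω → Vec q}
    (hθ : ∀ l ∈ s, ∀ k, Measurable[sampleHistory W T k] (θ l k))
    {F : ℕ → Vec q × (ℝ≥0 → Vec q) → ℝ} (hF : ∀ l ∈ s, Measurable (F l))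
    {b : ℕ → ℝ} (hb : ∀ l ∈ s, 0 ≤ b l)
    (hF_zero : ∀ l ∈ s, ∀ k j ω, ∫ ω', F l (θ l j ω, fun t => W l k t ω') ∂μ = 0)
    (hF_le : ∀ l ∈ s, ∀ k j ω, eLpNorm (fun ω' => F l (θ l j ω, fun t => W l k t ω'))
      (ENNReal.ofReal p) μ ≤ ENNReal.ofReal (b l)) :
    let J : Ω → ℝ := fun ω =>
      ∑ l ∈ s, a l / N l * ∑ k ∈ Finset.Icc 1 (N l), F l (θ l (k - 1) ω, fun t => W l k t ω)
    MemLp J (ENNReal.ofReal p) μ ∧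
      lpNorm J (ENNReal.ofReal p) μ ^ 2 ≤
        2 * expansionConst p * ∑ l ∈ s, a l ^ 2 / N l * b l ^ 2 := by
  have h_sq (l : ℕ) : a l ^ 2 / N l * b l ^ 2 = N l * (|a l / N l| * b l) ^ 2 := by
    rw [mul_pow, sq_abs, ← mul_assoc]
    rcases eq_or_ne (N l : ℝ) 0 with hN | hN
    · simp [hN]
    · field_simp
  have h_zero (l) (hl : l ∈ s) (k j : ℕ) (ω : Ω) :
      ∫ ω', a l / N l * F l (θ l j ω, fun t => W l k t ω') ∂μ = 0 := by
    rw [integral_const_mul, hF_zero l hl, mul_zero]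
  have h_le (l) (hl : l ∈ s) (k j : ℕ) (ω : Ω) :
      eLpNorm (fun ω' => a l / N l * F l (θ l j ω, fun t => W l k t ω')) (ENNReal.ofReal p) μ ≤
        ENNReal.ofReal (|a l / N l| * b l) := by
    refine (eLpNorm_const_smul (a l / N l : ℝ) _ _ _).trans_le ?_
    rw [Real.enorm_eq_ofReal_abs, ENNReal.ofReal_mul (abs_nonneg _)]
    gcongr
    exact hF_le l hl k j ω
  have h_samples := lpNorm_sum_samples_sq_le hp hW hind T s N hθ
    (F := fun l z => a l / N l * F l z) (fun l hl => (hF l hl).const_mul _)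
    (fun l hl => mul_nonneg (abs_nonneg _) (hb l hl)) h_zero h_le
  simpa only [← Finset.mul_sum, ← h_sq] using h_samples

end Multilevel

section CorrectionPart

variable {d q : ℕ} {Φ : ℝ → Vec d → Vec q → Vec d} {x : Vec d} {P : Vec d → ℝ}
  {Ω₀ : Type*} [MeasurableSpace Ω₀] {μ₀ : Measure Ω₀} {W₀ : ℝ≥0 → Ω₀ → Vec q}
  {X : ℝ≥0 → Ω₀ → Vec d} {Ω : Type*} [MeasurableSpace Ω] {μ : Measure Ω} [IsProbabilityMeasure μ]
  {W : ℕ → ℕ → ℝ≥0 → Ω → Vec q} {θ : ℕ → ℕ → Ω → Vec q}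

/-- The constant in front of `ε ^ 2` in the bound for the squared `L^p` norm of the correction
part: a Burkholder constant, the constant of the level terms, and the loss in the allocation. -/
noncomputable def correctionConst (M : ℕ) (β p c T V₁ r V : ℝ) : ℝ :=
  2 * expansionConst p * (levelConst T p c r V ^ 2 * ((M : ℝ) ^ β / V₁))

theorem correctionConst_pos {M : ℕ} (hM : 1 ≤ M) {p V₁ V : ℝ} (hp : 1 ≤ p) (hV₁ : 0 < V₁)
    (hV : 0 < V) (β c T r : ℝ) : 0 < correctionConst M β p c T V₁ r V := by
  have h_C := one_le_expansionConst hp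
  unfold correctionConst levelConst
  positivity

theorem lpNorm_correctionPart_sq_le {π : ML2RParams} {p c r V : ℝ} {T : ℝ≥0} {n₀ : ℕ}
    (hp : 2 ≤ p) (hM : 1 ≤ π.M) (hα : 0 ≤ π.α) (hβ : 0 ≤ π.β) (hh : π.h = T / n₀)
    (hV₁ : 0 < π.V₁) (hvar : 0 < π.var) (hT : T ≠ 0) (hn₀ : 1 ≤ n₀) (hpr : p < r) (hV : 0 ≤ V)
    (hW₀ : IsBrownianMotion W₀ μ₀) (hX : Measurable (X T)) (hP : Measurable P)
    (hΦ : ∀ h, Measurable fun z : Vec d × Vec q => Φ h z.1 z.2)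
    (hS : StrongError μ₀ Φ x T n₀ P W₀ X r π.β V) (hW : ∀ l k, IsBrownianMotion (W l k) μ)
    (hind : iIndepFun (fun (i : ℕ × ℕ) (ω : Ω) (t : ℝ≥0) => W i.1 i.2 t ω) μ)
    (hθ : ∀ l k, 2 ≤ l → Measurable[sampleHistory W T k] (θ l k))
    (hθ_le : ∀ l k, 2 ≤ l → ∀ ω, ‖θ l k ω‖ ≤ c) {ε : ℝ} (hε : ε ≠ 0) :
    let J := correctionPart π ε Φ x T n₀ P (levelMean μ₀ Φ x T n₀ π.M P W₀) θ W
    MemLp J (ENNReal.ofReal p) μ ∧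
      lpNorm J (ENNReal.ofReal p) μ ^ 2 ≤ correctionConst π.M π.β p c T π.V₁ r V * ε ^ 2 := by
  intro J
  have h_two {l : ℕ} (hl : l ∈ Finset.Icc 2 (π.depth ε)) : 2 ≤ l := (Finset.mem_Icc.1 hl).1
  have h_h : 0 < π.h := by
    rw [hh]
    positivity
  have h_levelConst : 0 ≤ levelConst T p c r V := by
    unfold levelConst
    positivity
  obtain ⟨h_mem, h_le⟩ := lpNorm_multilevel_sum_sq_le hp (fun l k => (hW l k).measurable_path) hind
    T (Finset.Icc 2 (π.depth ε)) (weight π.M π.α (π.depth ε)) (π.levelSize ε (π.depth ε))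
    (fun l hl k => hθ l k (h_two hl))
    (F := fun l z => levelTerm Φ x T n₀ π.M P (levelMean μ₀ Φ x T n₀ π.M P W₀ l) l z.1 z.2)
    (fun l _ => measurable_levelTerm hΦ hP n₀ π.M _ l)
    (b := fun l => levelConst T p c r V * ((T : ℝ) / n₀ / (π.M : ℝ) ^ (l - 2)) ^ (π.β / 2))
    (fun l _ => by positivity)
    (fun l hl k j ω => hW₀.integral_levelTerm_eq_zero (hW l k) hΦ hP hT (by omega) (by omega)
      (h_two hl) _)
    (fun l hl k j ω => hW₀.eLpNorm_levelTerm_le (hW l k) hΦ hP hT hX (by linarith) hpr hβ hV hS hn₀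
      hM (h_two hl) (hθ_le l j (h_two hl) ω))
  refine ⟨h_mem, h_le.trans ?_⟩
  have h_sq (l : ℕ) : (((T : ℝ) / n₀ / (π.M : ℝ) ^ (l - 2)) ^ (π.β / 2)) ^ 2 =
      (π.h / (π.M : ℝ) ^ (l - 2)) ^ π.β := by
    rw [hh, ← Real.rpow_mul_natCast (by positivity), Nat.cast_ofNat, div_mul_cancel₀ _ two_ne_zero]
  have h_C := one_le_expansionConst (p := p) (by linarith)
  rw [correctionConst, mul_assoc (2 * _), mul_assoc (_ ^ 2)]
  gcongr ?_ * ?_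
  simp only [mul_pow, h_sq, mul_left_comm _ (levelConst T p c r V ^ 2), ← Finset.mul_sum]
  gcongr ?_ * ?_
  exact ML2RParams.sum_sq_weight_div_levelSize_le hM hα h_h hV₁ hvar hε _

end CorrectionPart

theorem proposition2_general
    {M : ℕ} (hM : 2 ≤ M) {β : ℝ} (hβ : 0 ≤ β) {p : ℝ} (hp : 2 ≤ p) (c : ℝ)
    {T : ℝ≥0} (hT : 0 < T) {n₀ : ℕ} (hn₀ : 1 ≤ n₀)
    {V₁ : ℝ} (hV₁ : 0 < V₁) {r : ℝ} (hr : p < r) {Vr : ℝ} (hVr : 0 < Vr) :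
    ∃ K : ℝ, 0 < K ∧
      ∀ (d q : ℕ) (Ω₀ : Type*) [MeasurableSpace Ω₀] (μ₀ : Measure Ω₀) (W₀ : ℝ≥0 → Ω₀ → Vec q)
        (X : ℝ≥0 → Ω₀ → Vec d) (x : Vec d) (_ : IsBrownianMotion W₀ μ₀) (_ : Measurable (X T))
        (P : Vec d → ℝ) (_ : Measurable P) (Φ : ℝ → Vec d → Vec q → Vec d)
        (_ : ∀ h, Measurable fun z : Vec d × Vec q => Φ h z.1 z.2)
        (_ : StrongError μ₀ Φ x T n₀ P W₀ X r β Vr)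
        (α : ℝ) (_ : 0 < α) (var : ℝ) (_ : 0 < var) (cInf : ℝ)
        (Ω : Type*) [MeasurableSpace Ω] (μ : Measure Ω) [IsProbabilityMeasure μ]
        (W : ℕ → ℕ → ℝ≥0 → Ω → Vec q) (_ : ∀ l k, IsBrownianMotion (W l k) μ)
        (_ : iIndepFun (fun (i : ℕ × ℕ) (ω : Ω) (t : ℝ≥0) => W i.1 i.2 t ω) μ)
        (θ : ℕ → ℕ → Ω → Vec q)
        (_ : ∀ l k, 2 ≤ l → Measurable[sampleHistory W T k] (θ l k))
        (_ : ∀ l k, 2 ≤ l → ∀ ω, ‖θ l k ω‖ ≤ c)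
        (ε : ℝ) (_ : 0 < ε),
        let J : Ω → ℝ := correctionPart
          { M := M, α := α, β := β, h := (T : ℝ) / n₀, V₁ := V₁, var := var, cInf := cInf }
          ε Φ x T n₀ P (levelMean μ₀ Φ x T n₀ M P W₀) θ W
        Integrable (fun ω => |J ω| ^ p) μ ∧ ∫ ω, |J ω| ^ p ∂μ ≤ K * ε ^ p := by
  have hp0 : 0 < p := by linarith
  have hK := correctionConst_pos (by omega : 1 ≤ M) (by linarith : 1 ≤ p) hV₁ hVr β c T r
  refine ⟨√(correctionConst M β p c T V₁ r Vr) ^ p, Real.rpow_pos_of_pos (Real.sqrt_pos.2 hK) p,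
    fun d q Ω₀ _ μ₀ W₀ X x hW₀ hX P hP Φ hΦ hS α hα var hvar cInf Ω _ μ _ W hW hind θ hθ hθ_le ε
      hε => ?_⟩
  obtain ⟨h_mem, h_le⟩ := lpNorm_correctionPart_sq_le (π := ⟨M, α, β, T / n₀, V₁, var, cInf⟩)
    hp (one_le_two.trans hM) hα.le hβ rfl hV₁ hvar hT.ne' hn₀ hr hVr.le hW₀ hX hP hΦ hS hW hind hθ
    hθ_le hε.ne'
  refine ⟨integrable_abs_rpow_of_memLp hp0 h_mem, ?_⟩
  rw [← lpNorm_rpow_eq_integral hp0 h_mem.1, ← Real.mul_rpow (Real.sqrt_nonneg _) hε.le]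
  refine Real.rpow_le_rpow lpNorm_nonneg (le_of_sq_le_sq ?_ (by positivity)) hp0.le
  rwa [mul_pow, Real.sq_sqrt hK.le]

theorem proposition2
    (M : ℕ) (hM : 2 ≤ M) (β : ℝ) (hβ : 0 < β) (p : ℝ) (hp : 2 ≤ p) (c : ℝ) (hc : 0 < c)
    (T : ℝ≥0) (hT : 0 < T) (n₀ : ℕ) (hn₀ : 1 ≤ n₀)
    (V₁ : ℝ) (hV₁ : 0 < V₁) (r : ℝ) (hr : p < r) (Vr : ℝ) (hVr : 0 < Vr) :
    ∃ K : ℝ, 0 < K ∧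
      ∀ (d q : ℕ)
        -- the diffusion, on a filtered probability space
        (Ω₀ : Type*) [mΩ₀ : MeasurableSpace Ω₀] (μ₀ : Measure Ω₀) [IsProbabilityMeasure μ₀]
        (ℱ : Filtration ℝ≥0 mΩ₀) (W₀ : ℝ≥0 → Ω₀ → Vec q) (X : ℝ≥0 → Ω₀ → Vec d)
        (b : Vec d → Vec d) (σ : Fin q → Vec d → Vec d) (x : Vec d) (Kbσ : ℝ)
        (_ : ∀ y z, ‖b y - b z‖ + ∑ j, ‖σ j y - σ j z‖ ≤ Kbσ * ‖y - z‖)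
        (_ : IsFilteredBrownianMotion ℱ W₀ μ₀)
        (_ : IsStrongSolution ℱ μ₀ b σ x T W₀ X)
        -- the payoff and the discretization scheme
        (P : Vec d → ℝ) (_ : Measurable P)
        (_ : MemLp (fun ω => P (X T ω)) (ENNReal.ofReal p) μ₀)
        (_ : 0 < Var[fun ω => P (X T ω); μ₀])
        (Φ : ℝ → Vec d → Vec q → Vec d)
        (_ : ∀ h, Measurable fun z : Vec d × Vec q => Φ h z.1 z.2)
        -- strong and weak error assumptions
        (_ : StrongError μ₀ Φ x T n₀ P W₀ X 2 β V₁)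
        (_ : StrongError μ₀ Φ x T n₀ P W₀ X r β Vr)
        (α : ℝ) (_ : 0 < α) (coef : ℕ → ℝ)
        (_ : WeakError μ₀ Φ x T n₀ P W₀ X α coef)
        (cInf : ℝ) (_ : 0 < cInf)
        (_ : Tendsto (fun L : ℕ => |coef L| ^ (1 / (L : ℝ))) atTop (𝓝 cInf))
        -- the independent sample paths and the adaptive parameters
        (Ω : Type*) [MeasurableSpace Ω] (μ : Measure Ω) [IsProbabilityMeasure μ]
        (W : ℕ → ℕ → ℝ≥0 → Ω → Vec q)
        (_ : ∀ l k, IsBrownianMotion (W l k) μ)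
        (_ : iIndepFun (fun (i : ℕ × ℕ) (ω : Ω) (t : ℝ≥0) => W i.1 i.2 t ω) μ)
        (Θ : Set (Vec q)) (_ : IsCompact Θ) (_ : Θ ⊆ Metric.closedBall 0 c)
        (θ : ℕ → ℕ → Ω → Vec q)
        (_ : ∀ l k, 2 ≤ l → Measurable[sampleHistory W T k] (θ l k))
        (_ : ∀ l k, 2 ≤ l → ∀ ω, θ l k ω ∈ Θ)
        (ε : ℝ) (_ : 0 < ε),
        let J : Ω → ℝ := correctionPart
          { M := M, α := α, β := β, h := (T : ℝ) / n₀, V₁ := V₁,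
            var := Var[fun ω => P (X T ω); μ₀], cInf := cInf }
          ε Φ x T n₀ P (levelMean μ₀ Φ x T n₀ M P W₀) θ W
        Integrable (fun ω => |J ω| ^ p) μ ∧ ∫ ω, |J ω| ^ p ∂μ ≤ K * ε ^ p := by
  obtain ⟨K, hK, h⟩ := proposition2_general hM hβ.le hp c hT hn₀ hV₁ hr hVr
  exact ⟨K, hK, fun d q Ω₀ _ μ₀ _ ℱ W₀ X _ _ x _ _ hW₀ hX P hP _ hvar Φ hΦ _ hS α hα _ _ cInf _ _
    Ω _ μ _ W hW hind Θ _ hΘ θ hθ hθΘ => h d q Ω₀ μ₀ W₀ X x hW₀.isBrownianMotion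
      ((hX.adapted T le_rfl).mono (ℱ.le T) le_rfl) P hP Φ hΦ hS α hα _ hvar cInf Ω μ W hW hind θ hθ
      fun l k hl ω => mem_closedBall_zero_iff.1 (hΘ (hθΘ l k hl ω))⟩
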